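/- Let $n\ge 0$ and let $G_2\mathbb{R}^{2n+2}$ be the Grassmann manifold of oriented 2-planes through the origin in $\mathbb{R}^{2n+2}$; its tangent space at $P$ is identified with $\mathrm{Hom}(P,P^\perp)$ through the coordinates which send $L\in\mathrm{Hom}(P,P^\perp)$ to the graph of $L$, oriented by orthogonal projection to $P$. The bad set $BS(P)\subset G_2\mathbb{R}^{2n+2}$ consists of all oriented 2-planes which meet $P$ in at least a line, and the bad cone $BC(P)\subset T_P(G_2\mathbb{R}^{2n+2})$ is its tangent cone at $P$. A submanifold $M$ of $G_2\mathbb{R}^{2n+2}$ is transverse to the bad cone at $P\in M$ if $T_PM\cap BC(P)=\{0\}$. A smooth fibration of $S^{2n+1}$ by oriented great circles is a partition of $S^{2n+1}$ into oriented great circles such that each point has an open neighborhood, a union of these circles, which is diffeomorphic to $D\times S^1$ for some open set $D\subset\mathbb{R}^{2n}$, by a diffeomorphism under which the given oriented circles correspond to the oriented circles $\{d\}\times S^1$; its base space is the set of its fibres, each regarded as the point of $G_2\mathbb{R}^{2n+2}$ given by the oriented 2-plane that it spans. Let $M\subset G_2\mathbb{R}^{2n+2}$ be a nonempty connected closed (that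 is, compact and without boundary) smooth embedded $2n$-dimensional submanifold. Then $M$ is the base space of a smooth fibration of $S^{2n+1}$ by oriented great circles if and only if $M$ is transverse to the bad cone $BC(P)$ at each of its points $P$. -/

import Mathlib

open Set Metric Module Topology
open scoped Manifold ContDiff

noncomputable section

/-- Euclidean space `ℝ^{2n+2}`. -/
abbrev Euc (n : ℕ) : Type := EuclideanSpace ℝ (Fin (2 * n + 1 + 1))

/-- The unit sphere `S^{2n+1}` in `ℝ^{2n+2}`, with Mathlib's smooth structure. -/
abbrev Sph (n : ℕ) : Type := sphere (0 : Euc n) 1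

/-- A point of the Grassmann manifold `G_2 ℝ^{2n+2}`: an oriented 2-plane through the origin. -/
structure OrientedPlane (n : ℕ) where
  /-- the underlying 2-plane -/
  plane : Submodule ℝ (Euc n)
  finrank_plane : finrank ℝ plane = 2
  /-- the orientation of the 2-plane -/
  orientation : Orientation ℝ plane (Fin 2)

namespace OrientedPlane

variable {n : ℕ}

/-- The great circle `P ∩ S^{2n+1}`. -/
def greatCircle (P : OrientedPlane n) : Set (Sph n) := {x | (x : Euc n) ∈ P.plane}

/-- `(u, v)` is a positively oriented basis of the oriented plane `P`. -/
def IsPositiveFrame (P : OrientedPlane n) (u v : Euc n) : Prop :=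
  ∃ b : Basis (Fin 2) ℝ P.plane,
    (b 0 : Euc n) = u ∧ (b 1 : Euc n) = v ∧ b.orientation = P.orientation

/-- `Hom(P, P^⊥)`: both the coordinate neighbourhood of `P` in the Grassmann manifold and its
tangent space at `P`. -/
abbrev HomPerp (P : OrientedPlane n) : Type := P.plane →L[ℝ] (P.planeᗮ : Submodule ℝ (Euc n))

/-- The map `p ↦ p + L p` from `P` to `ℝ^{2n+2} = P + P^⊥`, whose image is the graph of `L`. -/
def graphMap (P : OrientedPlane n) (L : P.HomPerp) : P.plane →ₗ[ℝ] Euc n :=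
  P.plane.subtype + P.planeᗮ.subtype ∘ₗ L.toLinearMap

theorem graphMap_injective (P : OrientedPlane n) (L : P.HomPerp) :
    Function.Injective (P.graphMap L) := by
  rw [← LinearMap.ker_eq_bot, LinearMap.ker_eq_bot']
  intro p hp
  have h1 : (p : Euc n) + (L p : Euc n) = 0 := hp
  have h2 : inner ℝ (p : Euc n) (L p : Euc n) = 0 :=
    (Submodule.mem_orthogonal _ _).1 (L p).2 _ p.2
  have h3 : inner ℝ (p : Euc n) ((p : Euc n) + (L p : Euc n)) = 0 := by rw [h1, inner_zero_right]
  rw [inner_add_right, h2, add_zero, inner_self_eq_zero] at h3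
  exact Subtype.ext h3

/-- The standard coordinates of the Grassmann manifold around `P` (from coordinates to points):
`L ∈ Hom(P, P^⊥)` is sent to the graph of `L`, oriented so that its orthogonal projection
`p + L p ↦ p` back to `P` preserves orientations.
This is a bijection from `Hom(P, P^⊥)` onto the set of the oriented planes which contain no nonzero
vector orthogonal to `P` and whose orthogonal projection to `P` is orientation preserving. -/
def graph (P : OrientedPlane n) (L : P.HomPerp) : OrientedPlane n where
  plane := LinearMap.range (P.graphMap L)
  finrank_plane := by
    rw [LinearMap.finrank_range_of_inj (P.graphMap_injective L), P.finrank_plane]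
  orientation := Orientation.map (Fin 2)
    (LinearEquiv.ofInjective (P.graphMap L) (P.graphMap_injective L)) P.orientation

/-- The manifold topology of `G_2 ℝ^{2n+2}`: a set of oriented planes is open if and only if its
image in each of the coordinate spaces `Hom(P, P^⊥)` is open. -/
instance : TopologicalSpace (OrientedPlane n) :=
  ⨆ P : OrientedPlane n, TopologicalSpace.coinduced P.graph inferInstance

/-- The bad set `BS(P)`: the oriented 2-planes which meet `P` in at least a line. -/
def badSet (P : OrientedPlane n) : Set (OrientedPlane n) := {Q | P.plane ⊓ Q.plane ≠ ⊥}

/-- The bad cone `BC(P)` in `T_P (G_2 ℝ^{2n+2}) = Hom(P, P^⊥)`: the tangent cone at `P` of the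
bad set, taken in the coordinates centred at `P`. -/
def badCone (P : OrientedPlane n) : Set P.HomPerp := posTangentConeAt (P.graph ⁻¹' P.badSet) 0

end OrientedPlane

/-- Near the point `x`, the subset `S` of `V` is a smooth embedded submanifold of dimension `k`:
some smooth diffeomorphism `Ψ` between open subsets of `V`, the first of which contains `x`,
straightens `S` to a `k`-dimensional linear subspace. -/
def IsSmoothSubmanifoldAt {V : Type*} [NormedAddCommGroup V] [NormedSpace ℝ V]
    (k : ℕ) (S : Set V) (x : V) : Prop :=
  ∃ (Ψ : OpenPartialHomeomorph V V) (W : Submodule ℝ V),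
    finrank ℝ W = k ∧ x ∈ Ψ.source ∧
    ContDiffOn ℝ ∞ Ψ Ψ.source ∧ ContDiffOn ℝ ∞ Ψ.symm Ψ.target ∧
    x ∈ S ∧ ∀ y ∈ Ψ.source, (y ∈ S ↔ Ψ y ∈ W)

/-- The set of velocities at `x` of the smooth curves which run in `S`; this is the tangent space
`T_x S` if `S` is a smooth submanifold. -/
def velocitySet {V : Type*} [NormedAddCommGroup V] [NormedSpace ℝ V] (S : Set V) (x : V) : Set V :=
  {v | ∃ ε > 0, ∃ γ : ℝ → V, ContDiffOn ℝ ∞ γ (Ioo (-ε) ε) ∧ (∀ t ∈ Ioo (-ε) ε, γ t ∈ S) ∧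
    γ 0 = x ∧ HasDerivAt γ v 0}

namespace OrientedPlane

variable {n : ℕ}

/-- `M` is a smooth embedded `k`-dimensional submanifold (without boundary) of `G_2 ℝ^{2n+2}`. -/
def IsSmoothSubmanifold (k : ℕ) (M : Set (OrientedPlane n)) : Prop :=
  ∀ P ∈ M, IsSmoothSubmanifoldAt k (P.graph ⁻¹' M) 0

/-- The tangent space `T_P M`, as a subset of `T_P (G_2 ℝ^{2n+2}) = Hom(P, P^⊥)`. -/
def tangentSpaceAt (M : Set (OrientedPlane n)) (P : OrientedPlane n) : Set P.HomPerp :=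
  velocitySet (P.graph ⁻¹' M) 0

/-- `M` is transverse to the bad cone at `P`: `T_P M` meets `BC(P)` only at the origin. -/
def IsTransverseToBadCone (M : Set (OrientedPlane n)) (P : OrientedPlane n) : Prop :=
  tangentSpaceAt M P ∩ P.badCone = {0}

end OrientedPlane

/-- A smooth fibration of `S^{2n+1}` by oriented great circles: the sphere is the disjoint union of
oriented great circles, and near each point there is a diffeomorphism from an open subset of the
sphere onto a product `D × S^1`, with `D` open in `ℝ^{2n}`, for which the circles `{d} × S^1` with
their standard orientation correspond to the given oriented great circles. -/
structure SmoothGreatCircleFibration (n : ℕ) where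
  /-- the oriented great circle of the fibration which passes through a point -/
  fibre : Sph n → OrientedPlane n
  mem_fibre : ∀ x, x ∈ (fibre x).greatCircle
  fibre_eq : ∀ x y, y ∈ (fibre x).greatCircle → fibre y = fibre x
  locally_trivial : ∀ x : Sph n,
    ∃ (D : Set (EuclideanSpace ℝ (Fin (2 * n))))
      (Φ : OpenPartialHomeomorph (Sph n) (EuclideanSpace ℝ (Fin (2 * n)) × Circle)),
      x ∈ Φ.source ∧ Φ.target = D ×ˢ univ ∧
      ContMDiffOn (𝓡 (2 * n + 1)) ((𝓡 (2 * n)).prod (𝓡 1)) ∞ Φ Φ.source ∧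
      ContMDiffOn ((𝓡 (2 * n)).prod (𝓡 1)) (𝓡 (2 * n + 1)) ∞ Φ.symm Φ.target ∧
      ∀ d ∈ D, ∃ y : Sph n,
        range (fun z : Circle => Φ.symm (d, z)) = (fibre y).greatCircle ∧
        ∀ θ : ℝ, (fibre y).IsPositiveFrame (Φ.symm (d, Circle.exp θ) : Euc n)
          (deriv (fun s : ℝ => (Φ.symm (d, Circle.exp s) : Euc n)) θ)

/-- The base space of the fibration: the set of its fibres, as points of `G_2 ℝ^{2n+2}`. -/
def SmoothGreatCircleFibration.baseSpace {n : ℕ} (F : SmoothGreatCircleFibration n) :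
    Set (OrientedPlane n) := range F.fibre

end

noncomputable section

open scoped RealInnerProductSpace
open Filter

namespace OrientedPlane

variable {n : ℕ}

/-! ### Positive frames -/

/-! In the coordinates `graph` centred at `P`, the bad set is the set of non-injective linear maps.
This set is closed and invariant under scaling, so it is its own tangent cone (`mem_badCone`).
Transversality at `P` therefore says that the pairing `(h, p) ↦ dψ(h) p`, for a parametrization `ψ`
of `M`, has no zero divisors.

Suppose `M` is transverse. By compactness of unit spheres the pairing is bounded below, and strict
differentiability carries the bound over to differences: `c ‖w - w'‖ ‖p‖ ≤ ‖ψ w p - ψ w' p‖` near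
`0` (`TransverseChart`). Hence neighbouring planes of `M` meet only at the origin, and `(w, z) ↦ α z
+ ψ w (α z)`, with `z ≠ 0`, is an injective immersion between spaces of dimension `2n + 2`, that is,
a diffeomorphism onto an open set (`exists_planes_chart`). So the bundle of circles over `M` maps to
the sphere by a local homeomorphism, which is a covering because the bundle is compact. It is
bijective (`bijective_proj`): over the sphere minus a point, a copy of a vector space, the covering
has a section, and the part of the bundle lying there is connected, since `M` is connected and each
circle loses at most one point; so the section fills it. Puncturing the sphere also covers `n = 0`,
where `S^1` is not simply connected. Radial normalization then gives the local trivializations.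

Conversely, let `γ` be a curve of fibres through `P` with velocity `v` and `v p = 0` for a unit
vector `p`. The point `p + γ(t) p` starts with velocity zero; so does its label in a local
trivialization, and so do all points carried along by that trivialization. These points stay on the
graphs of `γ(t)`, which forces `v = 0` on the whole circle of `P` (`velocity_eq_zero`). -/

theorem exists_orthonormal_frame (P : OrientedPlane n) :
    ∃ b : OrthonormalBasis (Fin 2) ℝ P.plane, b.toBasis.orientation = P.orientation :=
  ⟨P.orientation.finOrthonormalBasis two_pos P.finrank_plane,
    P.orientation.finOrthonormalBasis_orientation two_pos P.finrank_plane⟩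

/-- A basis of a 2-plane obtained from another one by a change of basis of positive determinant. -/
theorem IsPositiveFrame.change {P : OrientedPlane n} {u v : Euc n} (h : P.IsPositiveFrame u v)
    {a b c d : ℝ} (hdet : 0 < a * d - b * c) :
    P.IsPositiveFrame (a • u + b • v) (c • u + d • v) := by
  obtain ⟨e, rfl, rfl, ho⟩ := h
  set w : Fin 2 → P.plane := ![a • e 0 + b • e 1, c • e 0 + d • e 1] with hw
  have hd : e.det w = a * d - b * c := by
    rw [Basis.det_apply, Matrix.det_fin_two]
    simp [Basis.toMatrix_apply, hw]
    ring
  have hu := (Module.Basis.is_basis_iff_det e (v := w)).2 (by rw [hd]; exact hdet.ne'.isUnit)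
  refine ⟨Basis.mk hu.1 hu.2.ge, by simp [hw], by simp [hw], ?_⟩
  rw [← ho, eq_comm, Basis.orientation_eq_iff_det_pos, Basis.coe_mk, hd]
  exact hdet

theorem IsPositiveFrame.exists_change {P : OrientedPlane n} {u v u' v' : Euc n}
    (h : P.IsPositiveFrame u v) (h' : P.IsPositiveFrame u' v') :
    ∃ a b c d : ℝ, 0 < a * d - b * c ∧ u' = a • u + b • v ∧ v' = c • u + d • v := by
  obtain ⟨e, rfl, rfl, ho⟩ := h
  obtain ⟨e', rfl, rfl, ho'⟩ := h'
  refine ⟨e.repr (e' 0) 0, e.repr (e' 0) 1, e.repr (e' 1) 0, e.repr (e' 1) 1, ?_, ?_, ?_⟩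
  · have := (Basis.orientation_eq_iff_det_pos e e').1 (ho.trans ho'.symm)
    rw [Basis.det_apply, Matrix.det_fin_two] at this
    simp only [Basis.toMatrix_apply] at this
    linarith
  · have := e.sum_repr (e' 0)
    rw [Fin.sum_univ_two] at this
    exact_mod_cast congrArg Subtype.val this.symm
  · have := e.sum_repr (e' 1)
    rw [Fin.sum_univ_two] at this
    exact_mod_cast congrArg Subtype.val this.symm

theorem IsPositiveFrame.plane_eq {P : OrientedPlane n} {u v : Euc n} (h : P.IsPositiveFrame u v) :
    P.plane = Submodule.span ℝ {u, v} := by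
  obtain ⟨e, rfl, rfl, -⟩ := h
  have := congrArg (Submodule.map P.plane.subtype) e.span_eq
  rw [Submodule.map_span, Submodule.map_subtype_top] at this
  refine this.symm.trans (congrArg _ ?_)
  ext x
  simp [Fin.exists_fin_two, eq_comm]

/-- A frame determines both the span and the orientation; equalities of oriented planes are proved
by exhibiting a common frame. -/
theorem IsPositiveFrame.ext {P Q : OrientedPlane n} {u v : Euc n} (h : P.IsPositiveFrame u v)
    (h' : Q.IsPositiveFrame u v) : P = Q := by
  have hp := h.plane_eq.trans h'.plane_eq.symm
  obtain ⟨p, hp1, o⟩ := P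
  obtain ⟨q, hq1, o'⟩ := Q
  obtain rfl : p = q := hp
  obtain ⟨e, he0, he1, he⟩ := h
  obtain ⟨e', he0', he1', he'⟩ := h'
  change e.orientation = o at he
  change e'.orientation = o' at he'
  have : e = e' := by
    ext i : 2
    fin_cases i
    · exact he0.trans he0'.symm
    · exact he1.trans he1'.symm
  rw [← he, ← he', this]

theorem IsPositiveFrame.linearIndependent {P : OrientedPlane n} {u v : Euc n}
    (h : P.IsPositiveFrame u v) : LinearIndependent ℝ ![u, v] := by
  obtain ⟨e, rfl, rfl, -⟩ := h
  have := e.linearIndependent.map' P.plane.subtype (Submodule.ker_subtype _)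
  have h2 : P.plane.subtype ∘ e = ![(e 0 : Euc n), e 1] := by
    ext i : 1
    fin_cases i <;> rfl
  rwa [h2] at this

theorem IsPositiveFrame.graph {P : OrientedPlane n} {u v : P.plane}
    (h : P.IsPositiveFrame u v) (L : P.HomPerp) :
    (P.graph L).IsPositiveFrame (P.graphMap L u) (P.graphMap L v) := by
  obtain ⟨e, h0, h1, ho⟩ := h
  obtain rfl := Subtype.ext h0
  obtain rfl := Subtype.ext h1
  refine ⟨e.map (LinearEquiv.ofInjective (P.graphMap L) (P.graphMap_injective L)), rfl, rfl, ?_⟩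
  exact (Basis.orientation_map e _).trans (congrArg _ ho)

theorem graph_zero (P : OrientedPlane n) : P.graph 0 = P := by
  obtain ⟨b, hb⟩ := P.exists_orthonormal_frame
  have h : P.IsPositiveFrame (b 0 : Euc n) (b 1 : Euc n) := ⟨b.toBasis, by simp, by simp, hb⟩
  refine IsPositiveFrame.ext (h.graph 0) ?_
  simpa [graphMap] using h

/-! ### The bad cone -/

/-- If `q + L q` lies in `P`, then `L q` lies in both `P` and its orthogonal complement, so it
vanishes. -/
theorem badSet_graph (P : OrientedPlane n) :
    P.graph ⁻¹' P.badSet = {L : P.HomPerp | ∃ p : P.plane, p ≠ 0 ∧ L p = 0} := by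
  ext L
  simp only [badSet, mem_preimage, mem_ofPred_eq, Submodule.ne_bot_iff, Submodule.mem_inf]
  constructor
  · rintro ⟨x, ⟨hx, q, rfl⟩, hx0⟩
    have hq : (L q : Euc n) ∈ P.plane := by
      have := P.plane.sub_mem hx q.2
      simpa [graphMap] using this
    have hL : L q = 0 := by
      have := (Submodule.mem_orthogonal _ _).1 (L q).2 _ hq
      rw [inner_self_eq_zero] at this
      exact Subtype.ext this
    refine ⟨q, ?_, hL⟩
    rintro rfl
    exact hx0 (by simp)
  · rintro ⟨p, hp, hL⟩
    exact ⟨p, ⟨p.2, p, by simp [graphMap, hL]⟩, by simpa using hp⟩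

/-- Kernel vectors can be normalized, and projection along the compact unit sphere of `P` is a
closed map. -/
theorem isClosed_not_injective (P : OrientedPlane n) :
    IsClosed {L : P.HomPerp | ∃ p : P.plane, p ≠ 0 ∧ L p = 0} := by
  have : {L : P.HomPerp | ∃ p : P.plane, p ≠ 0 ∧ L p = 0} =
      Prod.snd '' {q : sphere (0 : P.plane) 1 × P.HomPerp | q.2 q.1 = 0} := by
    ext L
    constructor
    · rintro ⟨p, hp, hL⟩
      refine ⟨(⟨‖p‖⁻¹ • p, by simp [norm_smul, hp]⟩, L), by simp [hL], rfl⟩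
    · rintro ⟨⟨p, L⟩, h, rfl⟩
      exact ⟨p, ne_zero_of_mem_unit_sphere p, h⟩
  rw [this]
  refine isClosedMap_snd_of_compactSpace _ (isClosed_eq ?_ continuous_const)
  exact (continuous_snd).clm_apply (continuous_subtype_val.comp continuous_fst)

theorem mem_badCone {P : OrientedPlane n} {L : P.HomPerp} :
    L ∈ P.badCone ↔ ∃ p : P.plane, p ≠ 0 ∧ L p = 0 := by
  rw [badCone, badSet_graph]
  constructor
  · intro h
    obtain ⟨α, l, hl, c, d, hd, hmem, hlim⟩ := exists_fun_of_mem_tangentConeAt h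
    refine P.isClosed_not_injective.mem_of_tendsto hlim (hmem.mono ?_)
    rintro i ⟨p, hp, hL⟩
    refine ⟨p, hp, ?_⟩
    rw [zero_add] at hL
    simp [hL]
  · rintro ⟨p, hp, hL⟩
    -- The whole ray through `L` consists of maps that kill `p`.
    refine mem_posTangentConeAt_of_frequently_mem (E := P.HomPerp) (Eventually.frequently (Eventually.of_forall ?_))
    intro t
    exact ⟨p, hp, by simp [hL]⟩

theorem exists_ne_zero (P : OrientedPlane n) : ∃ p : P.plane, p ≠ 0 := by
  have : Nontrivial P.plane := by
    apply Module.nontrivial_of_finrank_pos (R := ℝ); rw [P.finrank_plane]; exact two_pos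
  exact _root_.exists_ne 0

end OrientedPlane

/-! ### Oriented planes as quarter turns, and the topology of the Grassmann manifold -/

/-- The infinitesimal rotation `u ∧ v`. -/
def wedge {V : Type*} [NormedAddCommGroup V] [InnerProductSpace ℝ V] (u v : V) : V →L[ℝ] V :=
  (innerSL ℝ v).smulRight u - (innerSL ℝ u).smulRight v

/-- The Gram determinant of two vectors. -/
def gramDet {V : Type*} [NormedAddCommGroup V] [InnerProductSpace ℝ V] (u v : V) : ℝ :=
  ⟪u, u⟫ * ⟪v, v⟫ - ⟪u, v⟫ ^ 2

section Wedge

variable {V : Type*} [NormedAddCommGroup V] [InnerProductSpace ℝ V]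

theorem wedge_apply (u v x : V) : wedge u v x = ⟪v, x⟫ • u - ⟪u, x⟫ • v := rfl

/-- The factor is the determinant of the change of frame; together with `gramDet_change` it shows
that `wedge u v / √(gramDet u v)` depends only on the oriented plane. -/
theorem wedge_change (u v : V) (a b c d : ℝ) :
    wedge (a • u + b • v) (c • u + d • v) = (a * d - b * c) • wedge u v := by
  ext x
  simp only [wedge_apply, inner_add_left, real_inner_smul_left, smul_apply]
  module

theorem gramDet_change (u v : V) (a b c d : ℝ) :
    gramDet (a • u + b • v) (c • u + d • v) = (a * d - b * c) ^ 2 * gramDet u v := by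
  simp only [gramDet, inner_add_left, inner_add_right, real_inner_smul_left,
    real_inner_smul_right, real_inner_comm u v]
  ring

theorem gramDet_pos {u v : V} (h : LinearIndependent ℝ ![u, v]) : 0 < gramDet u v := by
  have hu : u ≠ 0 := h.ne_zero 0
  have hw : ⟪u, u⟫ • v - ⟪u, v⟫ • u ≠ 0 := by
    intro h0
    have := LinearIndependent.pair_iff.1 h (-⟪u, v⟫) ⟪u, u⟫ (by rw [← h0]; module)
    exact hu (inner_self_eq_zero.1 this.2)
  have h1 : 0 < ⟪u, u⟫ := real_inner_self_pos.2 hu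
  have h2 := real_inner_self_pos.2 hw
  have h3 : ⟪⟪u, u⟫ • v - ⟪u, v⟫ • u, ⟪u, u⟫ • v - ⟪u, v⟫ • u⟫ = ⟪u, u⟫ * gramDet u v := by
    simp only [gramDet, inner_sub_left, inner_sub_right, real_inner_smul_left,
      real_inner_smul_right, real_inner_comm u v]
    ring
  rw [h3] at h2
  exact pos_of_mul_pos_right h2 h1.le

theorem wedge_wedge_of_mem_span {u v x : V} (hx : x ∈ Submodule.span ℝ {u, v}) :
    wedge u v (wedge u v x) = -gramDet u v • x := by
  obtain ⟨a, b, rfl⟩ := Submodule.mem_span_pair.1 hx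
  simp only [wedge_apply, gramDet, inner_add_right, inner_sub_right, real_inner_smul_right,
    real_inner_comm u v]
  module

theorem Continuous.wedge {X : Type*} [TopologicalSpace X] {f g : X → V} (hf : Continuous f)
    (hg : Continuous g) : Continuous fun x => _root_.wedge (f x) (g x) := by
  have h : ∀ {f g : X → V}, Continuous f → Continuous g →
      Continuous fun x => (innerSL ℝ (g x)).smulRight (f x) := fun hf hg =>
    (ContinuousLinearMap.smulRightL ℝ V V).continuous₂.comp
      (((innerSL ℝ).continuous.comp hg).prodMk hf)
  exact (h hf hg).sub (h hg hf)

/-- The linear map with given values at the orthonormal vectors `e` and `f`. -/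
def frameMap {F : Type*} [NormedAddCommGroup F] [NormedSpace ℝ F] (e f : V) (a : F × F) :
    V →L[ℝ] F :=
  (innerSL ℝ e).smulRight a.1 + (innerSL ℝ f).smulRight a.2

theorem frameMap_apply {F : Type*} [NormedAddCommGroup F] [NormedSpace ℝ F] (e f : V) (a : F × F)
    (x : V) : frameMap e f a x = ⟪e, x⟫ • a.1 + ⟪f, x⟫ • a.2 := rfl

theorem continuous_frameMap {F : Type*} [NormedAddCommGroup F] [NormedSpace ℝ F] (e f : V) :
    Continuous (frameMap e f : F × F → V →L[ℝ] F) :=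
  ((ContinuousLinearMap.smulRightL ℝ V F (innerSL ℝ e)).continuous.comp continuous_fst).add
    ((ContinuousLinearMap.smulRightL ℝ V F (innerSL ℝ f)).continuous.comp continuous_snd)

end Wedge

namespace OrientedPlane

variable {n : ℕ}

theorem exists_positiveFrame (P : OrientedPlane n) :
    ∃ u v : P.plane, P.IsPositiveFrame u v ∧ ⟪u, u⟫ = 1 ∧ ⟪v, v⟫ = 1 ∧ ⟪u, v⟫ = 0 := by
  obtain ⟨b, hb⟩ := P.exists_orthonormal_frame
  refine ⟨b 0, b 1, ⟨b.toBasis, by simp, by simp, hb⟩, ?_, ?_, ?_⟩ <;>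
  simp [b.inner_eq_ite]

/-- The rotation by a quarter turn in the oriented plane `P`, precomposed with the orthogonal
projection to `P`. -/
def rot (P : OrientedPlane n) : Euc n →L[ℝ] Euc n :=
  wedge (P.exists_positiveFrame.choose : Euc n) (P.exists_positiveFrame.choose_spec.choose)

theorem IsPositiveFrame.rot_eq {P : OrientedPlane n} {u v : Euc n} (h : P.IsPositiveFrame u v) :
    P.rot = (√(gramDet u v))⁻¹ • wedge u v := by
  obtain ⟨hf, h1, h2, h3⟩ := P.exists_positiveFrame.choose_spec.choose_spec
  rw [rot]
  generalize P.exists_positiveFrame.choose_spec.choose = f at *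
  generalize P.exists_positiveFrame.choose = e at *
  obtain ⟨a, b, c, d, hdet, rfl, rfl⟩ := hf.exists_change h
  have hg : gramDet (e : Euc n) (f : Euc n) = 1 := by
    simp only [gramDet, ← Submodule.coe_inner, h1, h2, h3]
    norm_num
  rw [wedge_change, gramDet_change, hg, mul_one, Real.sqrt_sq hdet.le, smul_smul,
    inv_mul_cancel₀ hdet.ne', one_smul]

theorem rot_mem (P : OrientedPlane n) (x : Euc n) : P.rot x ∈ P.plane :=
  P.plane.sub_mem (P.plane.smul_mem _ (Subtype.property _))
    (P.plane.smul_mem _ (Subtype.property _))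

theorem rot_rot_of_mem {P : OrientedPlane n} {x : Euc n} (hx : x ∈ P.plane) :
    P.rot (P.rot x) = -x := by
  obtain ⟨u, v, h, -⟩ := P.exists_positiveFrame
  have hg := gramDet_pos h.linearIndependent
  rw [h.plane_eq] at hx
  rw [h.rot_eq]
  simp only [smul_apply, map_smul, wedge_wedge_of_mem_span hx, smul_smul]
  have : (√(gramDet (u : Euc n) v))⁻¹ * ((√(gramDet (u : Euc n) v))⁻¹ * -gramDet (u : Euc n) v)
      = -1 := by
    have h2 := Real.mul_self_sqrt hg.le
    have h3 := (Real.sqrt_pos.2 hg).ne'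
    field_simp
    rw [sq, h2]
  rw [this, neg_one_smul]

/-- Expresses incidence as an equation that is continuous in the plane and the vector jointly. -/
theorem mem_plane_iff {P : OrientedPlane n} {x : Euc n} :
    x ∈ P.plane ↔ P.rot (P.rot x) = -x := by
  refine ⟨rot_rot_of_mem, fun h => ?_⟩
  rw [← neg_neg x, ← h]
  exact P.plane.neg_mem (P.rot_mem _)

theorem graphMap_apply (P : OrientedPlane n) (L : P.HomPerp) (p : P.plane) :
    P.graphMap L p = p + L p := rfl

theorem IsPositiveFrame.inner_rot {Q : OrientedPlane n} {u v : Euc n} (h : Q.IsPositiveFrame u v)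
    (e f : Euc n) :
    ⟪e, Q.rot f⟫ = (√(gramDet u v))⁻¹ * (⟪e, u⟫ * ⟪f, v⟫ - ⟪f, u⟫ * ⟪e, v⟫) := by
  simp only [h.rot_eq, smul_apply, wedge_apply, real_inner_smul_right, inner_sub_right,
    real_inner_comm f]
  ring

theorem inner_graphMap (P : OrientedPlane n) (L : P.HomPerp) (p q : P.plane) :
    ⟪(p : Euc n), P.graphMap L q⟫ = ⟪p, q⟫ := by
  have : ⟪(p : Euc n), (L q : Euc n)⟫ = 0 := (Submodule.mem_orthogonal _ _).1 (L q).2 _ p.2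
  simp [graphMap, inner_add_right, this]

theorem eq_inner_smul_add {P : OrientedPlane n} {e f : P.plane} (h : P.IsPositiveFrame e f)
    (he : ⟪e, e⟫ = 1) (hf : ⟪f, f⟫ = 1) (hef : ⟪e, f⟫ = 0) (p : P.plane) :
    p = ⟪e, p⟫ • e + ⟪f, p⟫ • f := by
  obtain ⟨a, b, hab⟩ := Submodule.mem_span_pair.1 (h.plane_eq.le p.2)
  have he' : ⟪(e : Euc n), (e : Euc n)⟫ = 1 := he
  have hf' : ⟪(f : Euc n), (f : Euc n)⟫ = 1 := hf
  have hef' : ⟪(e : Euc n), (f : Euc n)⟫ = 0 := hef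
  have h1 : ⟪e, p⟫ = a := by
    rw [Submodule.coe_inner, ← hab, inner_add_right, real_inner_smul_right, real_inner_smul_right,
      he', hef']
    ring
  have h2 : ⟪f, p⟫ = b := by
    rw [Submodule.coe_inner, ← hab, inner_add_right, real_inner_smul_right, real_inner_smul_right,
      hf', real_inner_comm, hef']
    ring
  rw [h1, h2]
  exact Subtype.ext hab.symm

/-- An oriented plane is the graph of a linear map over `P` if its orthogonal projection to `P` is
an orientation preserving isomorphism. -/
theorem mem_range_graph_iff {P Q : OrientedPlane n} {e f : P.plane} (h : P.IsPositiveFrame e f)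
    (he : ⟪e, e⟫ = 1) (hf : ⟪f, f⟫ = 1) (hef : ⟪e, f⟫ = 0) :
    Q ∈ range P.graph ↔ 0 < ⟪(e : Euc n), Q.rot f⟫ := by
  constructor
  · rintro ⟨L, rfl⟩
    rw [(h.graph L).inner_rot]
    simp only [inner_graphMap, he, hf, hef, real_inner_comm e f]
    have := Real.sqrt_pos.2 (gramDet_pos (h.graph L).linearIndependent)
    rw [mul_one, mul_zero, sub_zero, mul_one]
    exact inv_pos.2 this
  · intro hpos
    obtain ⟨u, v, hQ, -⟩ := Q.exists_positiveFrame
    rw [hQ.inner_rot] at hpos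
    have hg := Real.sqrt_pos.2 (gramDet_pos hQ.linearIndependent)
    set D := ⟪(e : Euc n), u⟫ * ⟪(f : Euc n), v⟫ - ⟪(f : Euc n), u⟫ * ⟪(e : Euc n), v⟫ with hD
    have hD0 : 0 < D := pos_of_mul_pos_right hpos (inv_nonneg.2 hg.le)
    -- Cramer's rule: the coefficients invert the matrix of the projection of `(u, v)` in the basis
    -- `(e, f)`, so the new frame of `Q` projects exactly to `(e, f)`.
    have hQ' := hQ.change (a := D⁻¹ * ⟪(f : Euc n), v⟫) (b := -(D⁻¹ * ⟪(f : Euc n), u⟫))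
      (c := -(D⁻¹ * ⟪(e : Euc n), v⟫)) (d := D⁻¹ * ⟪(e : Euc n), u⟫) (by
        have : D⁻¹ * ⟪(f : Euc n), v⟫ * (D⁻¹ * ⟪(e : Euc n), u⟫) -
          -(D⁻¹ * ⟪(f : Euc n), u⟫) * -(D⁻¹ * ⟪(e : Euc n), v⟫) = D⁻¹ * D⁻¹ * D := by
          rw [hD]; ring
        rw [this]; positivity)
    have hmem : ∀ w : Euc n, ⟪(e : Euc n), w⟫ = 0 → ⟪(f : Euc n), w⟫ = 0 → w ∈ P.planeᗮ := by
      intro w hew hfw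
      rw [Submodule.mem_orthogonal]
      intro p hp
      rw [h.plane_eq, Submodule.mem_span_pair] at hp
      obtain ⟨a, b, rfl⟩ := hp
      simp [inner_add_left, real_inner_smul_left, hew, hfw]
    have he' : ⟪(e : Euc n), (e : Euc n)⟫ = 1 := he
    have hf' : ⟪(f : Euc n), (f : Euc n)⟫ = 1 := hf
    have hef' : ⟪(e : Euc n), (f : Euc n)⟫ = 0 := hef
    have hfe' : ⟪(f : Euc n), (e : Euc n)⟫ = 0 := by rw [real_inner_comm, hef']
    have hDD : D⁻¹ * D = 1 := inv_mul_cancel₀ hD0.ne'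
    have hu := hmem ((D⁻¹ * ⟪(f : Euc n), v⟫) • (u : Euc n) + (-(D⁻¹ * ⟪(f : Euc n), u⟫)) • v - e)
      (by simp only [inner_sub_right, inner_add_right, real_inner_smul_right, he']
          linear_combination hDD + D⁻¹ * hD)
      (by simp only [inner_sub_right, inner_add_right, real_inner_smul_right, hfe']; ring)
    have hv := hmem ((-(D⁻¹ * ⟪(e : Euc n), v⟫)) • (u : Euc n) + (D⁻¹ * ⟪(e : Euc n), u⟫) • v - f)
      (by simp only [inner_sub_right, inner_add_right, real_inner_smul_right, hef']; ring)
      (by simp only [inner_sub_right, inner_add_right, real_inner_smul_right, hf']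
          linear_combination hDD + D⁻¹ * hD)
    refine ⟨frameMap e f (⟨_, hu⟩, ⟨_, hv⟩), (h.graph _).ext ?_⟩
    have hfe : ⟪f, e⟫ = 0 := hfe'
    convert hQ' using 1 <;>
    simp only [graphMap_apply, frameMap_apply, he, hf, hef, hfe, one_smul, zero_smul, add_zero,
      zero_add] <;>
    abel

theorem rot_graph {P : OrientedPlane n} {e f : P.plane} (h : P.IsPositiveFrame e f)
    (L : P.HomPerp) :
    (P.graph L).rot = (√(gramDet (P.graphMap L e) (P.graphMap L f)))⁻¹ •
      wedge (P.graphMap L e) (P.graphMap L f) := (h.graph L).rot_eq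

theorem continuous_graph (P : OrientedPlane n) : Continuous P.graph :=
  continuous_iff_coinduced_le.2 (le_iSup
    (fun P : OrientedPlane n => TopologicalSpace.coinduced P.graph inferInstance) P)

theorem continuous_iff_comp_graph {X : Type*} [TopologicalSpace X] {f : OrientedPlane n → X} :
    Continuous f ↔ ∀ P : OrientedPlane n, Continuous (f ∘ P.graph) := by
  refine ⟨fun h P => h.comp P.continuous_graph, fun h => ?_⟩
  rw [continuous_iSup_dom]
  exact fun P => continuous_coinduced_dom.2 (h P)

theorem continuous_graphMap (P : OrientedPlane n) (p : P.plane) :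
    Continuous fun L : P.HomPerp => P.graphMap L p :=
  continuous_const.add (continuous_subtype_val.comp
    (ContinuousLinearMap.apply ℝ _ p).continuous)

theorem continuous_rot : Continuous (rot : OrientedPlane n → _) := by
  rw [continuous_iff_comp_graph]
  intro P
  obtain ⟨e, f, h, -⟩ := P.exists_positiveFrame
  have : (rot ∘ P.graph) = fun L => (√(gramDet (P.graphMap L e) (P.graphMap L f)))⁻¹ •
      wedge (P.graphMap L e) (P.graphMap L f) := funext fun L => rot_graph h L
  rw [this]
  have h1 := P.continuous_graphMap e
  have h2 := P.continuous_graphMap f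
  refine Continuous.smul (Continuous.inv₀ (G₀ := ℝ) ?_ fun L => ?_) (h1.wedge h2)
  · exact (((h1.inner h1).mul (h2.inner h2)).sub ((h1.inner h2).pow 2)).sqrt
  · exact (Real.sqrt_pos.2 (gramDet_pos (h.graph L).linearIndependent)).ne'

/-- The operator detects both being a graph over `P` and the underlying plane, and the only graph
with underlying plane `P` is that of `0`. With continuity this makes the Grassmann manifold
Hausdorff. -/
theorem rot_injective : Function.Injective (rot : OrientedPlane n → _) := by
  intro P Q hPQ
  obtain ⟨e, f, h, he, hf, hef⟩ := P.exists_positiveFrame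
  have h1 : Q ∈ range P.graph := by
    rw [mem_range_graph_iff h he hf hef, ← hPQ, ← mem_range_graph_iff h he hf hef]
    exact ⟨0, P.graph_zero⟩
  obtain ⟨L, rfl⟩ := h1
  have hL : L = 0 := by
    ext p : 1
    have h2 : (p : Euc n) ∈ (P.graph L).plane := by
      rw [mem_plane_iff, ← hPQ, ← mem_plane_iff]
      exact p.2
    obtain ⟨q, hq⟩ := h2
    have h3 : (q : Euc n) + L q = p := hq
    have h4 : (L q : Euc n) ∈ P.plane := by
      rw [show (L q : Euc n) = p - q by rw [← h3]; abel]
      exact P.plane.sub_mem p.2 q.2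
    have h5 : L q = 0 := by
      have := (Submodule.mem_orthogonal _ _).1 (L q).2 _ h4
      rw [inner_self_eq_zero] at this
      exact Subtype.ext this
    rw [h5] at h3
    have h6 : q = p := Subtype.ext (by simpa using h3)
    rw [← h6, h5]
    rfl
  rw [hL, P.graph_zero]

instance : T2Space (OrientedPlane n) := T2Space.of_injective_continuous rot_injective continuous_rot

/-- For a final topology it is not automatic that coordinate images are open; the inverse is
therefore written in terms of `rot`, which is continuous for that topology. -/
theorem isOpenEmbedding_graph (P : OrientedPlane n) : IsOpenEmbedding P.graph := by
  obtain ⟨e, f, h, he, hf, hef⟩ := P.exists_positiveFrame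
  have hfe : ⟪f, e⟫ = 0 := by rw [real_inner_comm, hef]
  let π := P.planeᗮ.orthogonalProjectionOnto
  let c : OrientedPlane n → ℝ := fun Q => ⟪(e : Euc n), Q.rot f⟫
  -- On the graph of `L`, `rot f` and `rot e` are `c (e + L e)` and `-c (f + L f)`; dividing by `c`
  -- and projecting to the complement recovers `L e` and `L f`.
  let inv : OrientedPlane n → P.HomPerp := fun Q =>
    frameMap e f ((c Q)⁻¹ • π (Q.rot f), -(c Q)⁻¹ • π (Q.rot e))
  have hπ : ∀ (L : P.HomPerp) p, π (P.graphMap L p) = L p := by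
    intro L p
    have h1 : π (p : Euc n) = 0 :=
      Submodule.orthogonalProjectionOnto_apply_of_mem_orthogonal
        (Submodule.le_orthogonal_orthogonal _ p.2)
    have h2 : π (L p : Euc n) = L p :=
      Submodule.orthogonalProjectionOnto_mem_subspace_eq_self _
    rw [graphMap_apply, map_add, h1, h2, zero_add]
  have hinv : ∀ L : P.HomPerp, inv (P.graph L) = L := by
    intro L
    have hc := (Real.sqrt_pos.2 (gramDet_pos (h.graph L).linearIndependent)).ne'
    have h1 : (P.graph L).rot f = (√(gramDet (P.graphMap L e) (P.graphMap L f)))⁻¹ •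
        P.graphMap L e := by
      rw [rot_graph h, smul_apply, wedge_apply, real_inner_comm,
        real_inner_comm _ (P.graphMap L e), inner_graphMap, inner_graphMap, hf, hfe, one_smul,
        zero_smul, sub_zero]
    have h2 : (P.graph L).rot e = -(√(gramDet (P.graphMap L e) (P.graphMap L f)))⁻¹ •
        P.graphMap L f := by
      rw [rot_graph h, smul_apply, wedge_apply, real_inner_comm,
        real_inner_comm _ (P.graphMap L e), inner_graphMap, inner_graphMap, he, hef, one_smul,
        zero_smul, zero_sub, smul_neg, neg_smul]
    have h3 : c (P.graph L) = (√(gramDet (P.graphMap L e) (P.graphMap L f)))⁻¹ := by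
      simp only [c, h1, real_inner_smul_right, inner_graphMap, he, mul_one]
    ext p : 1
    simp only [inv, frameMap_apply, h3, h1, h2, map_smul, hπ, neg_smul, smul_neg, map_neg, neg_neg,
      smul_smul, inv_inv]
    rw [mul_inv_cancel₀ hc, mul_one, mul_one, ← map_smul, ← map_smul, ← map_add,
      ← eq_inner_smul_add h he hf hef p]
  have hrot : ∀ x : Euc n, Continuous fun Q : OrientedPlane n => Q.rot x := fun x =>
    continuous_rot.clm_apply continuous_const
  have hc : Continuous c := continuous_const.inner (hrot f)
  refine .of_continuous_injective_isOpenMap P.continuous_graph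
    (Function.LeftInverse.injective hinv) fun U hU => ?_
  have himage : P.graph '' U = {Q : OrientedPlane n | 0 < c Q} ∩ inv ⁻¹' U := by
    ext Q
    rw [mem_inter_iff, mem_ofPred_eq, ← mem_range_graph_iff h he hf hef]
    constructor
    · rintro ⟨L, hL, rfl⟩
      exact ⟨⟨L, rfl⟩, by rwa [mem_preimage, hinv]⟩
    · rintro ⟨⟨L, rfl⟩, hL⟩
      rw [mem_preimage, hinv] at hL
      exact ⟨L, hL, rfl⟩
  rw [himage]
  refine ContinuousOn.isOpen_inter_preimage ?_ (isOpen_lt continuous_const hc) hU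
  have hcinv : ContinuousOn (fun Q => (c Q)⁻¹) {Q : OrientedPlane n | 0 < c Q} :=
    hc.continuousOn.inv₀ fun Q hQ => ne_of_gt hQ
  exact (continuous_frameMap e f).comp_continuousOn
    ((hcinv.smul (π.continuous.comp (hrot f)).continuousOn).prodMk
      (hcinv.neg.smul (π.continuous.comp (hrot e)).continuousOn))

end OrientedPlane

/-! ### Parametrizations of submanifolds -/

/-- The parametrization is the inverse straightening map restricted to `W`. The last clause records
embeddedness: small balls fill relatively open pieces of `S`. -/
theorem IsSmoothSubmanifoldAt.exists_parametrization {V : Type*} [NormedAddCommGroup V]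
    [NormedSpace ℝ V] [FiniteDimensional ℝ V] {k : ℕ} {S : Set V} {x : V}
    (h : IsSmoothSubmanifoldAt k S x) :
    ∃ (ψ : EuclideanSpace ℝ (Fin k) → V) (r : ℝ), 0 < r ∧ ContDiffOn ℝ ∞ ψ (ball 0 r) ∧ ψ 0 = x ∧
      (∀ w ∈ ball 0 r, ψ w ∈ S) ∧ (∀ w, fderiv ℝ ψ 0 w ∈ velocitySet S x) ∧
      Function.Injective (fderiv ℝ ψ 0) ∧
      ∀ s ≤ r, ∃ O : Set V, IsOpen O ∧ ψ '' ball 0 s = O ∩ S := by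
  obtain ⟨Ψ, W, hW, hx, hΨ, hΨ', hxS, hmem⟩ := h
  obtain ⟨e⟩ : Nonempty (EuclideanSpace ℝ (Fin k) ≃L[ℝ] W) := by
    apply FiniteDimensional.nonempty_continuousLinearEquiv_of_finrank_eq
    rw [hW, finrank_euclideanSpace_fin]
  let ι : EuclideanSpace ℝ (Fin k) →L[ℝ] V := W.subtypeL ∘L e.toContinuousLinearMap
  have hι : Function.Injective ι := Subtype.val_injective.comp e.injective
  obtain ⟨l, hl⟩ := ι.toLinearMap.exists_leftInverse_of_injective (LinearMap.ker_eq_bot.2 hι)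
  have hlι : ∀ w, l.toContinuousLinearMap (ι w) = w := fun w => LinearMap.congr_fun hl w
  have hιW : ∀ w, ι w ∈ W := fun w => (e w).2
  have hxW : Ψ x ∈ W := (hmem x hx).1 hxS
  let a : EuclideanSpace ℝ (Fin k) → V := fun w => Ψ x + ι w
  have ha : ContDiff ℝ ∞ a := contDiff_const.add ι.contDiff
  have ha0 : a 0 = Ψ x := by simp [a]
  have hopen : IsOpen (a ⁻¹' Ψ.target) := Ψ.open_target.preimage ha.continuous
  obtain ⟨r, hr, hball⟩ := Metric.isOpen_iff.1 hopen 0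
    (by rw [mem_preimage, ha0]; exact Ψ.map_source hx)
  have hψ : ContDiffOn ℝ ∞ (Ψ.symm ∘ a) (ball 0 r) := hΨ'.comp ha.contDiffOn hball
  have hψ0 : (Ψ.symm ∘ a) 0 = x := by simp [ha0, Ψ.left_inv hx]
  have hψS : ∀ w ∈ ball 0 r, (Ψ.symm ∘ a) w ∈ S := fun w hw =>
    (hmem _ (Ψ.map_target (hball hw))).2 (by
      rw [Ψ.right_inv (hball hw)]; exact W.add_mem hxW (hιW w))
  have hd : HasFDerivAt (Ψ.symm ∘ a) (fderiv ℝ (Ψ.symm ∘ a) 0) 0 :=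
    ((hψ.contDiffAt (ball_mem_nhds _ hr)).differentiableAt (by simp)).hasFDerivAt
  refine ⟨Ψ.symm ∘ a, r, hr, hψ, hψ0, hψS, fun w => ?_, ?_, fun s hs => ?_⟩
  · have hcont : Continuous fun t : ℝ => t • w := continuous_id.smul continuous_const
    obtain ⟨ε, hε, hεb⟩ := Metric.isOpen_iff.1 (isOpen_ball.preimage hcont) 0
      (by rw [mem_preimage, zero_smul]; exact mem_ball_self hr)
    rw [Real.ball_eq_Ioo, zero_sub, zero_add] at hεb
    refine ⟨ε, hε, fun t => (Ψ.symm ∘ a) (t • w), ?_, fun t ht => hψS _ (hεb ht), ?_, ?_⟩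
    · exact hψ.comp (contDiff_id.smul contDiff_const).contDiffOn hεb
    · simp only [zero_smul]; exact hψ0
    · have h1 : HasDerivAt (fun t : ℝ => t • w) w 0 := by
        simpa using (hasDerivAt_id (0 : ℝ)).smul_const w
      have h2 : HasFDerivAt (Ψ.symm ∘ a) (fderiv ℝ (Ψ.symm ∘ a) 0) ((0 : ℝ) • w) := by
        rwa [zero_smul]
      exact h2.comp_hasDerivAt (0 : ℝ) h1
  · have h1 : HasFDerivAt Ψ (fderiv ℝ Ψ x) ((Ψ.symm ∘ a) 0) := by
      rw [hψ0]
      exact ((hΨ.contDiffAt (Ψ.open_source.mem_nhds hx)).differentiableAt (by simp)).hasFDerivAt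
    have h2 : HasFDerivAt a ι 0 := ι.hasFDerivAt.const_add _
    -- Differentiating this identity exhibits the injective `ι` as a composite through the
    -- derivative of the parametrization.
    have h3 : Ψ ∘ (Ψ.symm ∘ a) =ᶠ[𝓝 0] a := by
      filter_upwards [ball_mem_nhds _ hr] with w hw
      exact Ψ.right_inv (hball hw)
    have h4 := (h2.congr_of_eventuallyEq h3).unique (h1.comp 0 hd)
    intro w w' hww
    apply hι
    rw [h4, ContinuousLinearMap.comp_apply, ContinuousLinearMap.comp_apply, hww]
  · refine ⟨Ψ.source ∩ Ψ ⁻¹' {y | ‖l.toContinuousLinearMap (y - Ψ x)‖ < s}, ?_, ?_⟩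
    · refine Ψ.isOpen_inter_preimage (isOpen_lt ?_ continuous_const)
      exact (l.toContinuousLinearMap.continuous.comp (continuous_id.sub continuous_const)).norm
    · ext y
      constructor
      · rintro ⟨w, hw, rfl⟩
        have hw' := hball (ball_subset_ball hs hw)
        refine ⟨⟨Ψ.map_target hw', ?_⟩, hψS w (ball_subset_ball hs hw)⟩
        simp only [mem_preimage, mem_ofPred_eq, Function.comp_apply]
        rw [Ψ.right_inv hw']
        simp only [a, add_sub_cancel_left, hlι]
        simpa using hw
      · rintro ⟨⟨hy, hys⟩, hyS⟩
        have hyW : Ψ y - Ψ x ∈ W := W.sub_mem ((hmem y hy).1 hyS) hxW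
        have h1 : ι (e.symm ⟨_, hyW⟩) = Ψ y - Ψ x := by simp [ι]
        refine ⟨e.symm ⟨_, hyW⟩, ?_, ?_⟩
        · rw [mem_preimage, mem_ofPred_eq, ← h1, hlι] at hys
          simpa using hys
        · simp only [Function.comp_apply, a, h1, add_sub_cancel]
          exact Ψ.left_inv hy

/-! ### Quantitative transversality -/

/-- A bilinear map without zero divisors is bounded below. -/
theorem exists_pos_mul_norm_le {E F G : Type*} [NormedAddCommGroup E] [NormedSpace ℝ E]
    [FiniteDimensional ℝ E] [NormedAddCommGroup F] [NormedSpace ℝ F] [FiniteDimensional ℝ F]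
    [NormedAddCommGroup G] [NormedSpace ℝ G] (A : E →L[ℝ] F →L[ℝ] G)
    (hA : ∀ h p, A h p = 0 → h = 0 ∨ p = 0) :
    ∃ c > 0, ∀ h p, c * ‖h‖ * ‖p‖ ≤ ‖A h p‖ := by
  have hK : IsCompact (sphere (0 : E) 1 ×ˢ sphere (0 : F) 1) :=
    (isCompact_sphere _ _).prod (isCompact_sphere _ _)
  -- This form of the minimum principle also allows an empty compact set, as happens for `E = 0`
  -- when `n = 0`.
  obtain ⟨c, hc, hcK⟩ := hK.exists_forall_le' (f := fun q : E × F => ‖A q.1 q.2‖) (a := 0)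
    (by fun_prop) (by
      rintro ⟨h, p⟩ ⟨hh, hp⟩
      refine norm_pos_iff.2 fun h0 => ?_
      rcases hA h p h0 with rfl | rfl
      · simp at hh
      · simp at hp)
  refine ⟨c, hc, fun h p => ?_⟩
  rcases eq_or_ne h 0 with rfl | hh
  · simp
  rcases eq_or_ne p 0 with rfl | hp
  · simp
  have := hcK (‖h‖⁻¹ • h, ‖p‖⁻¹ • p) ⟨by simp [norm_smul, hh], by simp [norm_smul, hp]⟩
  simp only [map_smul, smul_apply, norm_smul, norm_inv, norm_norm] at this
  have hh' := norm_pos_iff.2 hh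
  have hp' := norm_pos_iff.2 hp
  calc c * ‖h‖ * ‖p‖ ≤ (‖p‖⁻¹ * (‖h‖⁻¹ * ‖A h p‖)) * ‖h‖ * ‖p‖ := by gcongr
    _ = ‖A h p‖ := by field_simp

/-- Strict differentiability makes the linearization error at most `c / 2 * ‖w - w'‖` for both
points near `a`, which costs half of the lower bound. -/
theorem exists_ball_mul_norm_le {E F G : Type*} [NormedAddCommGroup E] [NormedSpace ℝ E]
    [NormedAddCommGroup F] [NormedSpace ℝ F] [NormedAddCommGroup G] [NormedSpace ℝ G]
    {ψ : E → F →L[ℝ] G} {a : E} (hψ : ContDiffAt ℝ ∞ ψ a) {c : ℝ} (hc : 0 < c)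
    (hA : ∀ h p, c * ‖h‖ * ‖p‖ ≤ ‖fderiv ℝ ψ a h p‖) :
    ∃ s > 0, ∀ w ∈ ball a s, ∀ w' ∈ ball a s, ∀ p,
      c / 2 * ‖w - w'‖ * ‖p‖ ≤ ‖ψ w p - ψ w' p‖ := by
  set A := fderiv ℝ ψ a
  have hstrict : HasStrictFDerivAt ψ A a := hψ.hasStrictFDerivAt (by simp)
  have hev := hstrict.isLittleO.def (half_pos hc)
  rw [nhds_prod_eq] at hev
  obtain ⟨t, ht, htp⟩ := eventually_prod_self_iff'.1 hev
  obtain ⟨s, hs, hst⟩ := Metric.mem_nhds_iff.1 ht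
  refine ⟨s, hs, fun w hw w' hw' p => ?_⟩
  have h1 := htp w (hst hw) w' (hst hw')
  have h2 := hA (w - w') p
  have h3 : ‖(ψ w - ψ w' - A (w - w')) p‖ ≤ c / 2 * ‖w - w'‖ * ‖p‖ :=
    ((ψ w - ψ w' - A (w - w')).le_opNorm p).trans (by gcongr)
  have h4 : ‖A (w - w') p‖ ≤ ‖ψ w p - ψ w' p‖ + ‖(ψ w - ψ w' - A (w - w')) p‖ := by
    have : A (w - w') p = (ψ w p - ψ w' p) - (ψ w - ψ w' - A (w - w')) p := by
      simp only [sub_apply]; abel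
    rw [this]
    exact norm_sub_le _ _
  linarith

namespace OrientedPlane

variable {n : ℕ}

/-- A parametrization `ψ` of a neighbourhood of `P` in `M`, in the coordinates centred at `P`, such
that different planes of this neighbourhood meet only at the origin, in a quantitative sense. -/
structure TransverseChart (M : Set (OrientedPlane n)) (P : OrientedPlane n) where
  /-- the parametrization -/
  ψ : EuclideanSpace ℝ (Fin (2 * n)) → P.HomPerp
  /-- the radius of the domain -/
  r : ℝ
  /-- the lower bound of the angles -/
  c : ℝ
  r_pos : 0 < r
  c_pos : 0 < c
  contDiffOn : ContDiffOn ℝ ∞ ψ (ball 0 r)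
  ψ_zero : ψ 0 = 0
  graph_mem : ∀ w ∈ ball 0 r, P.graph (ψ w) ∈ M
  le_norm_sub : ∀ w ∈ ball 0 r, ∀ w' ∈ ball 0 r, ∀ p : P.plane,
    c * ‖w - w'‖ * ‖p‖ ≤ ‖ψ w p - ψ w' p‖
  exists_isOpen : ∃ O : Set P.HomPerp, IsOpen O ∧ ψ '' ball 0 r = O ∩ P.graph ⁻¹' M

/-- A zero divisor of the derivative pairing would give a nonzero tangent vector with a kernel, that
is, one in the bad cone. -/
theorem IsTransverseToBadCone.nonempty_transverseChart {M : Set (OrientedPlane n)}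
    {P : OrientedPlane n} (hM : IsSmoothSubmanifoldAt (2 * n) (P.graph ⁻¹' M) 0)
    (h : IsTransverseToBadCone M P) : Nonempty (TransverseChart M P) := by
  obtain ⟨ψ, r, hr, hψ, hψ0, hψS, hvel, hinj, hO⟩ := hM.exists_parametrization
  obtain ⟨c, hc, hcA⟩ := exists_pos_mul_norm_le (fderiv ℝ ψ 0) fun w p hwp => by
    by_contra! hne
    have h1 : fderiv ℝ ψ 0 w ∈ tangentSpaceAt M P ∩ P.badCone := ⟨hvel w, mem_badCone.2 ⟨p, hne.2, hwp⟩⟩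
    rw [h, mem_singleton_iff] at h1
    exact hne.1 (hinj (h1.trans (map_zero _).symm))
  obtain ⟨s, hs, hst⟩ := exists_ball_mul_norm_le (hψ.contDiffAt (ball_mem_nhds _ hr)) hc hcA
  have hsub : ball (0 : EuclideanSpace ℝ (Fin (2 * n))) (min r s) ⊆ ball 0 r :=
    ball_subset_ball (min_le_left _ _)
  have hsub' : ball (0 : EuclideanSpace ℝ (Fin (2 * n))) (min r s) ⊆ ball 0 s :=
    ball_subset_ball (min_le_right _ _)
  exact ⟨ψ, min r s, c / 2, lt_min hr hs, half_pos hc, hψ.mono hsub, hψ0,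
    fun w hw => hψS w (hsub hw), fun w hw w' hw' p => hst w (hsub' hw) w' (hsub' hw') p,
    hO _ (min_le_left _ _)⟩

end OrientedPlane

/-! ### Neighbouring planes sweep out an open set diffeomorphically -/

/-- An injective smooth map with injective derivatives between spaces of the same dimension is a
diffeomorphism onto an open set. -/
theorem exists_openPartialHomeomorph_of_injOn {E F : Type*} [NormedAddCommGroup E]
    [NormedSpace ℝ E] [FiniteDimensional ℝ E] [NormedAddCommGroup F] [NormedSpace ℝ F]
    [FiniteDimensional ℝ F] (hdim : finrank ℝ E = finrank ℝ F) {f : E → F} {U : Set E}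
    (hU : IsOpen U) (hf : ContDiffOn ℝ ∞ f U) (hinj : InjOn f U)
    (hd : ∀ x ∈ U, ∀ v, fderiv ℝ f x v = 0 → v = 0) :
    ∃ K : OpenPartialHomeomorph E F, K = f ∧ K.source = U ∧
      ContDiffOn ℝ ∞ K.symm K.target := by
  have : CompleteSpace E := FiniteDimensional.complete ℝ E
  have hcd : ∀ x ∈ U, ContDiffAt ℝ ∞ f x := fun x hx => hf.contDiffAt (hU.mem_nhds hx)
  let D : ∀ x ∈ U, E ≃L[ℝ] F := fun x hx =>
    (LinearEquiv.ofInjectiveOfFinrankEq (fderiv ℝ f x).toLinearMap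
      ((injective_iff_map_eq_zero _).2 (hd x hx)) hdim).toContinuousLinearEquiv
  have hD : ∀ x (hx : x ∈ U), HasStrictFDerivAt f (D x hx : E →L[ℝ] F) x := by
    intro x hx
    have h1 := (hcd x hx).hasStrictFDerivAt (by simp)
    have h2 : (D x hx : E →L[ℝ] F) = fderiv ℝ f x := by
      ext v; rfl
    rwa [h2]
  have hopen : IsOpenMap (U.domRestrict f) := by
    rw [isOpenMap_iff_nhds_le]
    rintro ⟨x, hx⟩
    change 𝓝 (f x) ≤ Filter.map (f ∘ Subtype.val) (𝓝 (⟨x, hx⟩ : U))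
    rw [← Filter.map_map, map_nhds_subtype_coe_eq_nhds hx (hU.mem_nhds hx),
      (hD x hx).map_nhds_eq_of_equiv]
  let K := OpenPartialHomeomorph.ofContinuousOpenRestrict (InjOn.toPartialEquiv f U hinj)
    hf.continuousOn hopen hU
  refine ⟨K, rfl, rfl, fun y hy => ContDiffAt.contDiffWithinAt ?_⟩
  have hx : K.symm y ∈ U := K.map_target hy
  exact K.contDiffAt_symm hy (hD _ hx).hasFDerivAt (hcd _ hx)

/-- A map which expands distances expands them infinitesimally. -/
theorem mul_norm_le_norm_fderiv {E F G : Type*} [NormedAddCommGroup E] [NormedSpace ℝ E]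
    [NormedAddCommGroup F] [NormedSpace ℝ F] [NormedAddCommGroup G] [NormedSpace ℝ G]
    {ψ : E → F →L[ℝ] G} {U : Set E} (hU : IsOpen U) {c : ℝ}
    (hψ : ∀ w ∈ U, ∀ w' ∈ U, ∀ p, c * ‖w - w'‖ * ‖p‖ ≤ ‖ψ w p - ψ w' p‖) {w : E} (hw : w ∈ U)
    (hd : DifferentiableAt ℝ ψ w) (h : E) (p : F) : c * ‖h‖ * ‖p‖ ≤ ‖fderiv ℝ ψ w h p‖ := by
  have h1 : HasDerivAt (fun t : ℝ => w + t • h) h 0 := by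
    simpa using ((hasDerivAt_id (0 : ℝ)).smul_const h).const_add w
  have h2 : HasFDerivAt ψ (fderiv ℝ ψ w) (w + (0 : ℝ) • h) := by
    rw [zero_smul, add_zero]; exact hd.hasFDerivAt
  have h3 : HasDerivAt (fun t : ℝ => ψ (w + t • h) p) (fderiv ℝ ψ w h p) 0 := by
    exact (ContinuousLinearMap.apply ℝ G p).hasFDerivAt.comp_hasDerivAt (0 : ℝ)
      (h2.comp_hasDerivAt (0 : ℝ) h1)
  -- The difference quotients satisfy the bound, hence so does their limit.
  refine ge_of_tendsto h3.tendsto_slope.norm ?_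
  have h4 : ∀ᶠ t : ℝ in 𝓝[≠] 0, w + t • h ∈ U := by
    refine h1.continuousAt.continuousWithinAt.eventually_mem (hU.mem_nhds ?_)
    simpa using hw
  filter_upwards [h4, self_mem_nhdsWithin] with t ht ht0
  have h5 := hψ _ ht w hw p
  have ht' : 0 < ‖t‖ := norm_pos_iff.2 ht0
  rw [add_sub_cancel_left, norm_smul] at h5
  rw [slope_def_module, sub_zero, zero_smul, add_zero, norm_smul, norm_inv]
  calc c * ‖h‖ * ‖p‖ = ‖t‖⁻¹ * (c * (‖t‖ * ‖h‖) * ‖p‖) := by field_simp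
    _ ≤ _ := by gcongr

theorem fderiv_add_clm_apply {E C F G H : Type*} [NormedAddCommGroup E] [NormedSpace ℝ E]
    [NormedAddCommGroup C] [NormedSpace ℝ C] [NormedAddCommGroup F] [NormedSpace ℝ F]
    [NormedAddCommGroup G] [NormedSpace ℝ G] [NormedAddCommGroup H] [NormedSpace ℝ H]
    {ψ : E → F →L[ℝ] G} (ι : F →L[ℝ] H) (B : G →L[ℝ] H) (A : C →L[ℝ] F) {w : E}
    (hψ : DifferentiableAt ℝ ψ w) (z : C) (v : E × C) :
    fderiv ℝ (fun q : E × C => ι (A q.2) + B (ψ q.1 (A q.2))) (w, z) v =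
      ι (A v.2) + B (ψ w (A v.2) + fderiv ℝ ψ w v.1 (A z)) := by
  have h1 : HasFDerivAt (fun q : E × C => ψ q.1)
      ((fderiv ℝ ψ w).comp (ContinuousLinearMap.fst ℝ E C)) (w, z) :=
    HasFDerivAt.comp (w, z) (g := ψ) (f := Prod.fst) hψ.hasFDerivAt hasFDerivAt_fst
  have h2 : HasFDerivAt (fun q : E × C => A q.2)
      (A.comp (ContinuousLinearMap.snd ℝ E C)) (w, z) :=
    HasFDerivAt.comp (w, z) A.hasFDerivAt hasFDerivAt_snd
  exact DFunLike.congr_fun ((ι.hasFDerivAt.comp (w, z) h2).add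
    (B.hasFDerivAt.comp (w, z) (h1.clm_apply h2))).fderiv v

namespace OrientedPlane

variable {n : ℕ}

theorem eq_zero_of_add_eq_zero {P : OrientedPlane n} {p : P.plane} {q : P.planeᗮ}
    (h : (p : Euc n) + q = 0) : p = 0 ∧ q = 0 := by
  have h1 : inner ℝ (p : Euc n) (q : Euc n) = 0 := (Submodule.mem_orthogonal _ _).1 q.2 _ p.2
  have h2 : inner ℝ (p : Euc n) ((p : Euc n) + q) = 0 := by rw [h, inner_zero_right]
  rw [inner_add_right, h1, add_zero, inner_self_eq_zero] at h2
  rw [h2, zero_add] at h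
  exact ⟨Subtype.ext h2, Subtype.ext h⟩

theorem eq_of_graphMap_eq {P : OrientedPlane n} {L L' : P.HomPerp} {p p' : P.plane}
    (h : P.graphMap L p = P.graphMap L' p') : p = p' ∧ L p = L' p' := by
  have : ((p - p' : P.plane) : Euc n) + (L p - L' p' : P.planeᗮ) = 0 := by
    rw [graphMap_apply, graphMap_apply, ← sub_eq_zero] at h
    rw [← h]
    push_cast
    abel
  have := eq_zero_of_add_eq_zero this
  exact ⟨sub_eq_zero.1 this.1, sub_eq_zero.1 this.2⟩

theorem exists_isometry (P : OrientedPlane n) :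
    ∃ α : ℂ ≃ₗᵢ[ℝ] P.plane, P.IsPositiveFrame (α 1) (α Complex.I) := by
  obtain ⟨b, hb⟩ := P.exists_orthonormal_frame
  refine ⟨Complex.isometryOfOrthonormal b, b.toBasis, ?_, ?_, hb⟩ <;>
  simp [Complex.isometryOfOrthonormal_apply]

namespace TransverseChart

variable {M : Set (OrientedPlane n)} {P : OrientedPlane n}

/-- The planes close to `P`, parametrized simultaneously. -/
def planes (T : TransverseChart M P) (α : ℂ ≃ₗᵢ[ℝ] P.plane)
    (q : EuclideanSpace ℝ (Fin (2 * n)) × ℂ) : Euc n :=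
  P.graphMap (T.ψ q.1) (α q.2)

theorem exists_planes_chart (T : TransverseChart M P) (α : ℂ ≃ₗᵢ[ℝ] P.plane) :
    ∃ K : OpenPartialHomeomorph (EuclideanSpace ℝ (Fin (2 * n)) × ℂ) (Euc n),
      K = T.planes α ∧ K.source = ball 0 T.r ×ˢ {0}ᶜ ∧
      ContDiffOn ℝ ∞ K K.source ∧ ContDiffOn ℝ ∞ K.symm K.target := by
  have hU : IsOpen (ball (0 : EuclideanSpace ℝ (Fin (2 * n))) T.r ×ˢ ({0}ᶜ : Set ℂ)) :=
    isOpen_ball.prod isOpen_compl_singleton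
  have hdiff : ContDiffOn ℝ ∞ (T.planes α) (ball 0 T.r ×ˢ {0}ᶜ) := by
    have h1 : ContDiffOn ℝ ∞ (fun q : EuclideanSpace ℝ (Fin (2 * n)) × ℂ => T.ψ q.1)
        (ball 0 T.r ×ˢ {0}ᶜ) := T.contDiffOn.comp contDiffOn_fst fun q hq => hq.1
    have h2 : ContDiff ℝ ∞ (fun q : EuclideanSpace ℝ (Fin (2 * n)) × ℂ => α q.2) :=
      α.contDiff.comp contDiff_snd
    exact (P.plane.subtypeL.contDiff.comp h2).contDiffOn.add
      (P.planeᗮ.subtypeL.contDiff.comp_contDiffOn (h1.clm_apply h2.contDiffOn))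
  -- The component in `P` determines `z`; since `z ≠ 0`, the chart's lower bound then separates
  -- different `w` by their components in the complement.
  have hinj : InjOn (T.planes α) (ball 0 T.r ×ˢ {0}ᶜ) := by
    rintro ⟨w, z⟩ ⟨hw, hz⟩ ⟨w', z'⟩ ⟨hw', hz'⟩ h
    obtain ⟨h1, h2⟩ := eq_of_graphMap_eq h
    obtain rfl : z = z' := α.injective h1
    have h3 := T.le_norm_sub w hw w' hw' (α z)
    rw [h2, sub_self, norm_zero, LinearIsometryEquiv.norm_map] at h3
    have h4 : ‖w - w'‖ = 0 := by
      by_contra hne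
      have h5 : 0 < ‖w - w'‖ := lt_of_le_of_ne (norm_nonneg _) (Ne.symm hne)
      have h6 : 0 < ‖z‖ := norm_pos_iff.2 hz
      have := T.c_pos
      have : 0 < T.c * ‖w - w'‖ * ‖z‖ := by positivity
      linarith
    rw [norm_sub_eq_zero_iff] at h4
    rw [h4]
  -- The infinitesimal version of the same argument: the `P`-component kills `ζ`, and the
  -- infinitesimal bound kills `h`.
  have hfd : ∀ q ∈ ball 0 T.r ×ˢ {0}ᶜ, ∀ v, fderiv ℝ (T.planes α) q v = 0 → v = 0 := by
    rintro ⟨w, z⟩ ⟨hw, hz⟩ ⟨h, ζ⟩ h0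
    have hψ : DifferentiableAt ℝ T.ψ w :=
      (T.contDiffOn.contDiffAt (isOpen_ball.mem_nhds hw)).differentiableAt (by simp)
    have h4 : ((α ζ : P.plane) : Euc n) +
      (T.ψ w (α ζ) + fderiv ℝ T.ψ w h (α z) : P.planeᗮ) = 0 :=
      (fderiv_add_clm_apply P.plane.subtypeL P.planeᗮ.subtypeL (α : ℂ →L[ℝ] P.plane) hψ z
        (h, ζ)).symm.trans h0
    obtain ⟨h5, h6⟩ := eq_zero_of_add_eq_zero h4
    rw [h5, map_zero, zero_add] at h6
    have h7 := mul_norm_le_norm_fderiv isOpen_ball T.le_norm_sub hw hψ h (α z)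
    rw [h6, norm_zero, LinearIsometryEquiv.norm_map] at h7
    have h8 : ‖h‖ = 0 := by
      by_contra hne
      have h5 : 0 < ‖h‖ := lt_of_le_of_ne (norm_nonneg _) (Ne.symm hne)
      have h6 : 0 < ‖z‖ := norm_pos_iff.2 hz
      have := T.c_pos
      have : 0 < T.c * ‖h‖ * ‖z‖ := by positivity
      linarith
    rw [norm_eq_zero] at h8
    rw [h8, (map_eq_zero_iff α α.injective).1 h5]
    rfl
  obtain ⟨K, hK, hKs, hK'⟩ := exists_openPartialHomeomorph_of_injOn
    (by simp [Complex.finrank_real_complex]) hU hdiff hinj hfd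
  exact ⟨K, hK, hKs, by rwa [hK, hKs], hK'⟩

end TransverseChart

end OrientedPlane

/-! ### The circle bundle over `M` as a covering of the sphere -/

/-- A set is preconnected if it has preconnected fibres over a preconnected space, and its
projection to this space is open. -/
theorem isPreconnected_of_fibres {X Y : Type*} [TopologicalSpace X] [TopologicalSpace Y]
    [PreconnectedSpace Y] {f : X → Y} {U : Set X} (hsurj : f '' U = univ)
    (hopen : ∀ V : Set X, IsOpen V → IsOpen (f '' (U ∩ V)))
    (hfib : ∀ y, IsPreconnected (U ∩ f ⁻¹' {y})) : IsPreconnected U := by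
  rintro u v hu hv hUuv ⟨x, hxU, hxu⟩ ⟨x', hx'U, hx'v⟩
  obtain ⟨y, -, ⟨x₁, ⟨hx₁U, hx₁u⟩, rfl⟩, x₂, ⟨hx₂U, hx₂v⟩, hx₂⟩ :=
    isPreconnected_univ (f '' (U ∩ u)) (f '' (U ∩ v)) (hopen u hu) (hopen v hv)
      (by rw [← image_union, ← inter_union_distrib_left, inter_eq_left.2 hUuv, hsurj])
      ⟨f x, mem_univ _, x, ⟨hxU, hxu⟩, rfl⟩ ⟨f x', mem_univ _, x', ⟨hx'U, hx'v⟩, rfl⟩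
  obtain ⟨z, hz, hzuv⟩ := hfib (f x₁) u v hu hv (inter_subset_left.trans hUuv)
    ⟨x₁, ⟨hx₁U, rfl⟩, hx₁u⟩ ⟨x₂, ⟨hx₂U, hx₂⟩, hx₂v⟩
  exact ⟨z, hz.1, hzuv⟩

theorem isPreconnected_sphere_compl {V : Type*} [NormedAddCommGroup V] [InnerProductSpace ℝ V]
    (a : sphere (0 : V) 1) :
    IsPreconnected ({a}ᶜ : Set (sphere (0 : V) 1)) := by
  have ha : ‖(a : V)‖ = 1 := norm_eq_of_mem_sphere a
  have := range_stereographic_symm ha a.2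
  rw [← this]
  exact isPreconnected_range (isOpenEmbedding_stereographic_symm ha).continuous

namespace OrientedPlane

variable {n : ℕ} {M : Set (OrientedPlane n)}

/-- The disjoint union of the great circles which belong to the planes of `M`. -/
def CircleBundle (M : Set (OrientedPlane n)) : Type :=
  {p : OrientedPlane n × Euc n // p.1 ∈ M ∧ p.2 ∈ p.1.plane ∧ ‖p.2‖ = 1}

namespace CircleBundle

instance : TopologicalSpace (CircleBundle M) := instTopologicalSpaceSubtype

instance : T2Space (CircleBundle M) := inferInstanceAs (T2Space (Subtype _))

/-- The plane of a point of the circle bundle. -/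
def base (e : CircleBundle M) : M := ⟨e.1.1, e.2.1⟩

/-- The position in the sphere of a point of the circle bundle. -/
def proj (e : CircleBundle M) : Sph n := ⟨e.1.2, by simpa using e.2.2.2⟩

/-- The point `x` of the plane `P`. -/
def mk (P : OrientedPlane n) (hP : P ∈ M) (x : Sph n) (hx : (x : Euc n) ∈ P.plane) :
    CircleBundle M := ⟨(P, x), hP, hx, norm_eq_of_mem_sphere x⟩

theorem isInducing_val :
    IsInducing (Subtype.val : CircleBundle M → OrientedPlane n × Euc n) := IsInducing.subtypeVal

theorem continuous_base : Continuous (base : CircleBundle M → M) :=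
  (continuous_fst.comp continuous_subtype_val).subtype_mk _

theorem continuous_proj : Continuous (proj : CircleBundle M → Sph n) :=
  (continuous_snd.comp continuous_subtype_val).subtype_mk _

theorem compactSpace (hM : IsCompact M) : CompactSpace (CircleBundle M) := by
  have h : IsCompact ((M ×ˢ sphere (0 : Euc n) 1) ∩
      {p : OrientedPlane n × Euc n | p.1.rot (p.1.rot p.2) = -p.2}) := by
    refine (hM.prod (isCompact_sphere _ _)).inter_right (isClosed_eq ?_ continuous_snd.neg)
    have h1 : Continuous fun p : OrientedPlane n × Euc n => p.1.rot :=
      continuous_rot.comp continuous_fst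
    exact h1.clm_apply (h1.clm_apply continuous_snd)
  refine isCompact_iff_compactSpace.1 (?_ : IsCompact {p : OrientedPlane n × Euc n |
    p.1 ∈ M ∧ p.2 ∈ p.1.plane ∧ ‖p.2‖ = 1})
  convert h using 1
  ext p
  simp only [mem_ofPred_eq, mem_inter_iff, mem_prod, mem_sphere_zero_iff_norm, mem_plane_iff]
  tauto

end CircleBundle

theorem exists_mem_norm_eq_one (P : OrientedPlane n) : ∃ x : Sph n, (x : Euc n) ∈ P.plane := by
  obtain ⟨u, v, -, hu, -⟩ := P.exists_positiveFrame
  refine ⟨⟨u, ?_⟩, u.2⟩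
  rw [mem_sphere_zero_iff_norm, ← sq_eq_sq₀ (norm_nonneg _) zero_le_one,
    ← real_inner_self_eq_norm_sq, one_pow]
  exact hu

namespace TransverseChart

variable {P : OrientedPlane n} {T : TransverseChart M P} {α : ℂ ≃ₗᵢ[ℝ] P.plane}
  {K : OpenPartialHomeomorph (EuclideanSpace ℝ (Fin (2 * n)) × ℂ) (Euc n)}

theorem mem_graph_of_mem_target (hK : K = T.planes α) {x : Euc n} (hx : x ∈ K.target) :
    x ∈ (P.graph (T.ψ (K.symm x).1)).plane := by
  have := K.right_inv hx
  rw [hK] at this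
  exact ⟨_, this⟩

theorem mem_target_of_mem_graph (hK : K = T.planes α) (hKs : K.source = ball 0 T.r ×ˢ {0}ᶜ)
    {x : Euc n} (hx0 : x ≠ 0) {w : EuclideanSpace ℝ (Fin (2 * n))} (hw : w ∈ ball 0 T.r)
    (hx : x ∈ (P.graph (T.ψ w)).plane) : x ∈ K.target ∧ (K.symm x).1 = w := by
  obtain ⟨p, rfl⟩ := hx
  have h1 : K (w, α.symm p) = P.graphMap (T.ψ w) p := by simp [hK, planes]
  have h2 : (w, α.symm p) ∈ K.source := by
    rw [hKs]
    refine ⟨hw, fun h : α.symm p = 0 => hx0 ?_⟩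
    rw [(map_eq_zero_iff _ α.symm.injective).1 h, map_zero]
  rw [← h1]
  exact ⟨K.map_source h2, by rw [K.left_inv h2]⟩

end TransverseChart

namespace CircleBundle

/-- The chart of planes finds, continuously in `x`, the nearby plane of `M` through `x`. -/
theorem isLocalHomeomorph_proj (hM : ∀ P ∈ M, Nonempty (TransverseChart M P)) :
    IsLocalHomeomorph (proj : CircleBundle M → Sph n) := by
  classical
  intro e₀
  obtain ⟨T⟩ := hM e₀.1.1 e₀.2.1
  set P := e₀.1.1 with hP
  obtain ⟨α, -⟩ := P.exists_isometry
  obtain ⟨K, hK, hKs, hKd, hKd'⟩ := T.exists_planes_chart α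
  obtain ⟨O, hO, hOψ⟩ := T.exists_isOpen
  have hball : ∀ x ∈ K.target, (K.symm x).1 ∈ ball 0 T.r := fun x hx => by
    have := K.map_target hx
    rw [hKs] at this
    exact this.1
  let inv : Sph n → CircleBundle M := fun x => if h : (x : Euc n) ∈ K.target then
    mk (P.graph (T.ψ (K.symm (x : Euc n)).1)) (T.graph_mem _ (hball _ h)) x
      (TransverseChart.mem_graph_of_mem_target hK h) else e₀
  have hinv : ∀ x : Sph n, (x : Euc n) ∈ K.target →
      (inv x).1 = (P.graph (T.ψ (K.symm (x : Euc n)).1), (x : Euc n)) := fun x hx => by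
    simp only [inv, dif_pos hx]; rfl
  have hsource : ∀ e : CircleBundle M, e.1.1 ∈ P.graph '' O → (e.1.2 : Euc n) ∈ K.target ∧
      P.graph (T.ψ (K.symm (e.1.2 : Euc n)).1) = e.1.1 := by
    rintro ⟨⟨Q, x⟩, hQ, hx, hx1⟩ ⟨L, hL, hLQ⟩
    obtain rfl : P.graph L = Q := hLQ
    obtain ⟨w, hw, rfl⟩ : L ∈ T.ψ '' ball 0 T.r := by rw [hOψ]; exact ⟨hL, hQ⟩
    have hx0 : x ≠ 0 := norm_ne_zero_iff.1 (by simp only at hx1; rw [hx1]; exact one_ne_zero)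
    obtain ⟨h1, h2⟩ := TransverseChart.mem_target_of_mem_graph hK hKs hx0 hw hx
    exact ⟨h1, by simp only [h2]⟩
  have hopen : IsOpen {e : CircleBundle M | e.1.1 ∈ P.graph '' O} :=
    (P.isOpenEmbedding_graph.isOpenMap O hO).preimage
      (continuous_subtype_val.comp (continuous_base (M := M)))
  have hcont : ContinuousOn inv {x : Sph n | (x : Euc n) ∈ K.target} := by
    refine isInducing_val.continuousOn_iff.2 ?_
    have h1 : ContinuousOn (fun x : Sph n => K.symm (x : Euc n))
        {x : Sph n | (x : Euc n) ∈ K.target} :=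
      K.continuousOn_symm.comp continuous_subtype_val.continuousOn fun x hx => hx
    have h2 : ContinuousOn (fun x : Sph n => T.ψ (K.symm (x : Euc n)).1)
        {x : Sph n | (x : Euc n) ∈ K.target} :=
      T.contDiffOn.continuousOn.comp (continuous_fst.comp_continuousOn h1) fun x hx => hball x hx
    exact ((P.continuous_graph.comp_continuousOn h2).prodMk
      continuous_subtype_val.continuousOn).congr fun x hx => hinv x hx
  refine ⟨
    { toFun := proj
      invFun := inv
      source := {e | e.1.1 ∈ P.graph '' O}
      target := {x | (x : Euc n) ∈ K.target}
      map_source' := fun e he => (hsource e he).1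
      map_target' := fun x hx => ?_
      left_inv' := fun e he => ?_
      right_inv' := fun x hx => Subtype.ext (congrArg Prod.snd (hinv x hx))
      open_source := hopen
      open_target := K.open_target.preimage continuous_subtype_val
      continuousOn_toFun := continuous_proj.continuousOn
      continuousOn_invFun := hcont }, ?_, rfl⟩
  · have h1 : T.ψ (K.symm (x : Euc n)).1 ∈ O ∩ P.graph ⁻¹' M := by
      rw [← hOψ]; exact ⟨_, hball _ hx, rfl⟩
    rw [mem_ofPred_eq, hinv x hx]
    exact ⟨_, h1.1, rfl⟩
  · obtain ⟨h1, h2⟩ := hsource e he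
    refine Subtype.ext ((hinv _ h1).trans ?_)
    exact Prod.ext h2 rfl
  · have h0 : (0 : P.HomPerp) ∈ T.ψ '' ball 0 T.r := ⟨0, mem_ball_self T.r_pos, T.ψ_zero⟩
    rw [hOψ] at h0
    exact ⟨0, h0.1, P.graph_zero⟩

/-- Through every point of the bundle there is a local section of `base`. -/
theorem isOpenMap_base : IsOpenMap (base : CircleBundle M → M) := by
  rw [isOpenMap_iff_nhds_le]
  rintro ⟨⟨P, x⟩, hP, hx, hx1⟩ S hS
  obtain ⟨W, hW, hWS⟩ := mem_nhds_subtype _ _ _ |>.1 hS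
  -- This is the orthogonal projection of `x` to `Q`; normalized, it is the section.
  let y : M → Euc n := fun Q => -Q.1.rot (Q.1.rot x)
  have hy : Continuous y := by
    have h1 : Continuous fun Q : M => Q.1.rot := continuous_rot.comp continuous_subtype_val
    exact (h1.clm_apply (h1.clm_apply continuous_const)).neg
  have hyP : y ⟨P, hP⟩ = x := by
    rw [← neg_neg x]; exact congrArg Neg.neg (rot_rot_of_mem hx)
  have hx1' : ‖x‖ = 1 := hx1
  have hx0 : x ≠ 0 := norm_ne_zero_iff.1 (by rw [hx1']; exact one_ne_zero)
  have hc : ContinuousAt (fun Q : M => (Q.1, ‖y Q‖⁻¹ • y Q)) ⟨P, hP⟩ :=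
    continuous_subtype_val.continuousAt.prodMk
      ((hy.norm.continuousAt.inv₀ (by rw [hyP, hx1']; exact one_ne_zero)).smul hy.continuousAt)
  have hval : (P, ‖y ⟨P, hP⟩‖⁻¹ • y ⟨P, hP⟩) = (P, x) := by
    rw [hyP, hx1', inv_one, one_smul]
  change S ∈ 𝓝 (⟨P, hP⟩ : M)
  filter_upwards [hc.preimage_mem_nhds (by rwa [hval]), hy.continuousAt.eventually_ne
    (by rwa [hyP] : y ⟨P, hP⟩ ≠ 0)] with Q hQ hQ0
  exact hWS (a := ⟨(Q.1, ‖y Q‖⁻¹ • y Q), Q.2,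
    Q.1.plane.smul_mem _ (Q.1.plane.neg_mem (Q.1.rot_mem _)), by simp [norm_smul, hQ0]⟩) hQ

/-- Over each plane lies a circle with at most one point removed, which is connected and nonempty;
`base` is open and `M` is connected. -/
theorem isPreconnected_proj_ne (hM : IsConnected M) (a : Sph n) :
    IsPreconnected {e : CircleBundle M | e.proj ≠ a} := by
  have : PreconnectedSpace M := Subtype.preconnectedSpace hM.isPreconnected
  refine isPreconnected_of_fibres (f := base) ?_ ?_ ?_
  · rw [eq_univ_iff_forall]
    rintro ⟨P, hP⟩
    obtain ⟨x, hx⟩ := P.exists_mem_norm_eq_one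
    by_cases hxa : x = a
    · refine ⟨mk P hP (-x) (P.plane.neg_mem hx), ?_, rfl⟩
      exact fun h => ne_neg_of_mem_unit_sphere ℝ x (hxa.trans h.symm)
    · exact ⟨mk P hP x hx, hxa, rfl⟩
  · exact fun V hV => isOpenMap_base _ ((isOpen_ne_fun continuous_proj continuous_const).inter hV)
  · rintro ⟨P, hP⟩
    have hP2 := P.finrank_plane
    let σ : sphere (0 : P.plane) 1 → CircleBundle M := fun p =>
      ⟨(P, ((p : P.plane) : Euc n)), hP, (p : P.plane).2, norm_eq_of_mem_sphere p⟩
    have hσ : Continuous σ := (continuous_const.prodMk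
      (continuous_subtype_val.comp continuous_subtype_val)).subtype_mk _
    have himage : {e : CircleBundle M | e.proj ≠ a} ∩ base ⁻¹' {⟨P, hP⟩} =
        σ '' {p | ((p : P.plane) : Euc n) ≠ a} := by
      ext ⟨⟨Q, x⟩, hQ, hx, hx1⟩
      constructor
      · rintro ⟨h1, h2⟩
        obtain rfl : Q = P := congrArg Subtype.val h2
        exact ⟨⟨⟨x, hx⟩, by simpa using hx1⟩, fun h => h1 (Subtype.ext h), rfl⟩
      · rintro ⟨p, hp, h⟩
        rw [← h]
        exact ⟨fun h => hp (congrArg Subtype.val h), rfl⟩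
    rw [himage]
    refine IsPreconnected.image ?_ σ hσ.continuousOn
    by_cases ha : (a : Euc n) ∈ P.plane
    · let a' : sphere (0 : P.plane) 1 :=
        ⟨⟨a, ha⟩, mem_sphere_zero_iff_norm.2 (norm_eq_of_mem_sphere a)⟩
      convert isPreconnected_sphere_compl a' using 1
      ext p
      exact not_congr ⟨fun h => Subtype.ext (Subtype.ext h),
        fun h => congrArg (fun q : sphere (0 : P.plane) 1 => ((q : P.plane) : Euc n)) h⟩
    · have : PreconnectedSpace (sphere (0 : P.plane) 1) :=
        Subtype.preconnectedSpace (isPreconnected_sphere (by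
          rw [← Module.finrank_eq_rank, hP2]; norm_num) _ _)
      convert isPreconnected_univ (α := sphere (0 : P.plane) 1) using 1
      refine eq_univ_of_forall fun p h => ha ?_
      rw [← h]
      exact (p : P.plane).2

theorem bijective_proj (hM : ∀ P ∈ M, Nonempty (TransverseChart M P)) (hcompact : IsCompact M)
    (hconn : IsConnected M) : Function.Bijective (proj : CircleBundle M → Sph n) := by
  have := compactSpace hcompact
  have hloc := isLocalHomeomorph_proj hM
  have hcov : IsCoveringMap (proj : CircleBundle M → Sph n) :=
    isLocalHomeomorph_iff_isCoveringMap.1 hloc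
  constructor
  · intro e₁ e₂ he
    set b := e₁.proj with hb
    have hab : b ≠ -b := (ne_neg_of_mem_unit_sphere ℝ b)
    have ha : ‖((-b : Sph n) : Euc n)‖ = 1 := norm_eq_of_mem_sphere _
    let s := stereographic ha
    have hs : s.source = {-b}ᶜ := by
      rw [stereographic_source]
    have hbs : b ∈ s.source := by rw [hs]; exact hab
    let f : C((Submodule.span ℝ {((-b : Sph n) : Euc n)})ᗮ, Sph n) :=
      ⟨s.symm, (isOpenEmbedding_stereographic_symm ha).continuous⟩
    -- Lifting the inverse stereographic chart from `e₁` gives a section over the sphere minus `-b`.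
    -- On the connected part of the bundle lying there, this section after `proj` and the identity
    -- are two lifts of `proj` that agree at `e₁`, hence also at `e₂`.
    obtain ⟨G, ⟨hG0, hG⟩, -⟩ := hcov.existsUnique_continuousMap_lifts f (s b) e₁
      (s.left_inv hbs).symm
    have heq := hcov.eqOn_of_comp_eqOn (isPreconnected_proj_ne hconn (-b))
      (g₁ := fun e => G (s e.proj)) (g₂ := id) ?_ continuousOn_id ?_ (a := e₁) hab hG0
    · have h2 := heq (show e₂.proj ≠ -b by rw [← he]; exact hab)
      simp only [← he, id] at h2
      exact hG0.symm.trans h2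
    · refine G.continuous.comp_continuousOn (s.continuousOn.comp continuous_proj.continuousOn ?_)
      intro e he
      rw [hs]
      exact he
    · intro e he
      have h3 : e.proj ∈ s.source := by rw [hs]; exact he
      have h4 := congrFun hG (s e.proj)
      exact h4.trans (s.left_inv h3)
  · have : PreconnectedSpace (Sph n) := Subtype.preconnectedSpace (isPreconnected_sphere (by
      rw [← Module.finrank_eq_rank, finrank_euclideanSpace_fin]; norm_cast; omega) _ _)
    rw [← range_eq_univ]
    -- The image is closed by compactness and open because `proj` is a local homeomorphism.
    refine IsClopen.eq_univ ⟨(isCompact_range continuous_proj).isClosed, hloc.isOpenMap.isOpen_range⟩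
      ?_
    obtain ⟨P, hP⟩ := hconn.nonempty
    obtain ⟨x, hx⟩ := P.exists_mem_norm_eq_one
    exact ⟨_, mk P hP x hx, rfl⟩

end CircleBundle

end OrientedPlane

/-! ### From transversality to a smooth fibration -/

/-- A map to the sphere is smooth if it is smooth as a map to the ambient space. -/
theorem contMDiffOn_sphere_of_coe {E : Type*} [NormedAddCommGroup E] [InnerProductSpace ℝ E]
    {m : ℕ} [Fact (finrank ℝ E = m + 1)] {F H N : Type*} [NormedAddCommGroup F]
    [NormedSpace ℝ F] [TopologicalSpace H] {I : ModelWithCorners ℝ F H} [TopologicalSpace N]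
    [ChartedSpace H N] {k : ℕ∞ω} [IsManifold I k N] {f : N → sphere (0 : E) 1} {s : Set N}
    (hf : ContMDiffOn I 𝓘(ℝ, E) k (fun x => (f x : E)) s) : ContMDiffOn I (𝓡 m) k f s := by
  rw [contMDiffOn_iff_target]
  refine ⟨IsInducing.subtypeVal.continuousOn_iff.2 hf.continuousOn, fun v => ?_⟩
  let U : _ ≃ₗᵢ[ℝ] _ :=
    (OrthonormalBasis.fromOrthogonalSpanSingleton
      m (ne_zero_of_mem_unit_sphere (-v))).repr
  have h : ContDiffOn ℝ ω _ Set.univ := U.contDiff.contDiffOn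
  have H₁ := (h.comp_inter contDiffOn_stereoToFun).contMDiffOn
  convert! (H₁.of_le le_top).comp' hf using 1
  ext x
  have hfxv : f x = -v ↔ ⟪(f x : E), -(v : E)⟫ = 1 := by
    rw [sphere_ext_iff]; rfl
  simp [chartAt, ChartedSpace.chartAt, hfxv, real_inner_comm]

namespace OrientedPlane

variable {n : ℕ} {M : Set (OrientedPlane n)}

theorem IsPositiveFrame.circle {Q : OrientedPlane n} {u v : Euc n} (h : Q.IsPositiveFrame u v)
    (θ : ℝ) :
    Q.IsPositiveFrame (‖Real.cos θ • u + Real.sin θ • v‖⁻¹ • (Real.cos θ • u + Real.sin θ • v))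
      (deriv (fun s => ‖Real.cos s • u + Real.sin s • v‖⁻¹ • (Real.cos s • u + Real.sin s • v))
        θ) := by
  have hc : HasDerivAt (fun s => Real.cos s • u + Real.sin s • v)
      (-Real.sin θ • u + Real.cos θ • v) θ :=
    ((Real.hasDerivAt_cos θ).smul_const u).add ((Real.hasDerivAt_sin θ).smul_const v)
  have hne : Real.cos θ • u + Real.sin θ • v ≠ 0 := by
    intro h0
    have h1 := LinearIndependent.pair_iff.1 h.linearIndependent _ _ h0
    have h2 := Real.sin_sq_add_cos_sq θ
    rw [h1.1, h1.2] at h2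
    norm_num at h2
  have hr : DifferentiableAt ℝ (fun s => ‖Real.cos s • u + Real.sin s • v‖⁻¹) θ :=
    (hc.differentiableAt.norm ℝ hne).inv (norm_ne_zero_iff.2 hne)
  obtain ⟨r', hr'⟩ : ∃ r', HasDerivAt (fun s => ‖Real.cos s • u + Real.sin s • v‖⁻¹) r' θ :=
    ⟨_, hr.hasDerivAt⟩
  rw [(hr'.fun_smul hc).deriv]
  have hpos : 0 < ‖Real.cos θ • u + Real.sin θ • v‖⁻¹ := inv_pos.2 (norm_pos_iff.2 hne)
  generalize ‖Real.cos θ • u + Real.sin θ • v‖⁻¹ = r at hpos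
  convert h.change (a := r * Real.cos θ) (b := r * Real.sin θ)
    (c := r' * Real.cos θ - r * Real.sin θ) (d := r' * Real.sin θ + r * Real.cos θ) ?_ using 1
  · module
  · module
  -- The derivative `r'` of the normalizing factor drops out of the determinant.
  · have : r * Real.cos θ * (r' * Real.sin θ + r * Real.cos θ) -
        r * Real.sin θ * (r' * Real.cos θ - r * Real.sin θ) = r ^ 2 := by
      linear_combination r ^ 2 * Real.sin_sq_add_cos_sq θ
    rw [this]
    positivity

namespace TransverseChart

variable {P : OrientedPlane n} (T : TransverseChart M P) (α : ℂ ≃ₗᵢ[ℝ] P.plane)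
  {K : OpenPartialHomeomorph (EuclideanSpace ℝ (Fin (2 * n)) × ℂ) (Euc n)}

theorem planes_smul (d : EuclideanSpace ℝ (Fin (2 * n))) (c : ℝ) (z : ℂ) :
    T.planes α (d, c • z) = c • T.planes α (d, z) := by
  simp only [planes, map_smul]

theorem planes_ne_zero (d : EuclideanSpace ℝ (Fin (2 * n))) {z : ℂ} (hz : z ≠ 0) :
    T.planes α (d, z) ≠ 0 := by
  intro h
  exact hz ((map_eq_zero_iff α α.injective).1
    ((map_eq_zero_iff _ (P.graphMap_injective _)).1 h))

/-- The parametrization of the great circles close to the great circle of `P`. -/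
def circles (q : EuclideanSpace ℝ (Fin (2 * n)) × Circle) : Sph n :=
  ⟨‖T.planes α (q.1, q.2)‖⁻¹ • T.planes α (q.1, q.2), by
    have := T.planes_ne_zero α q.1 (Circle.coe_ne_zero q.2)
    simp [norm_smul, this]⟩

theorem circles_mem (d : EuclideanSpace ℝ (Fin (2 * n))) (ζ : Circle) :
    (T.circles α (d, ζ) : Euc n) ∈ (P.graph (T.ψ d)).plane :=
  Submodule.smul_mem _ _ ⟨_, rfl⟩

theorem coe_circle_exp_arg {z : ℂ} (hz : z ≠ 0) : (Circle.exp z.arg : ℂ) = ‖z‖⁻¹ • z := by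
  have h := Complex.norm_mul_exp_arg_mul_I z
  have hz' : (‖z‖ : ℂ) ≠ 0 := by exact_mod_cast norm_ne_zero_iff.2 hz
  rw [Circle.coe_exp, Complex.real_smul, Complex.ofReal_inv, eq_inv_mul_iff_mul_eq₀ hz', h]

/-- The chart of planes is homogeneous in `z`, so it induces a chart between unit vectors by
normalizing on both sides. -/
theorem exists_circles_chart (hK : K = T.planes α) (hKs : K.source = ball 0 T.r ×ˢ {0}ᶜ)
    (hKd : ContDiffOn ℝ ∞ K K.source) (hKd' : ContDiffOn ℝ ∞ K.symm K.target) :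
    ∃ Φ : OpenPartialHomeomorph (Sph n) (EuclideanSpace ℝ (Fin (2 * n)) × Circle),
      Φ.source = {x : Sph n | (x : Euc n) ∈ K.target} ∧ Φ.target = ball 0 T.r ×ˢ univ ∧
      ContMDiffOn (𝓡 (2 * n + 1)) ((𝓡 (2 * n)).prod (𝓡 1)) ∞ Φ Φ.source ∧
      ContMDiffOn ((𝓡 (2 * n)).prod (𝓡 1)) (𝓡 (2 * n + 1)) ∞ Φ.symm Φ.target ∧
      (∀ x, (Φ x).1 = (K.symm (x : Euc n)).1) ∧ Φ.symm = T.circles α := by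
  have := Fact.mk (finrank_euclideanSpace_fin (𝕜 := ℝ) (n := 2 * n + 1 + 1))
  have := finrank_real_complex_fact'
  -- The discontinuity of `arg` is harmless: its exponential is `z / ‖z‖`, which is smooth for `z ≠
  -- 0`.
  let Φ₀ : Sph n → EuclideanSpace ℝ (Fin (2 * n)) × Circle := fun x =>
    ((K.symm (x : Euc n)).1, Circle.exp (K.symm (x : Euc n)).2.arg)
  have hsymm : ∀ x ∈ K.target, (K.symm x).1 ∈ ball 0 T.r ∧ (K.symm x).2 ≠ 0 := fun x hx => by
    have := K.map_target hx
    rwa [hKs] at this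
  have hcoe : ContMDiff (𝓡 (2 * n + 1)) 𝓘(ℝ, Euc n) ∞ (fun x : Sph n => (x : Euc n)) :=
    contMDiff_coe_sphere
  have h1 : ContMDiffOn (𝓡 (2 * n + 1)) 𝓘(ℝ, EuclideanSpace ℝ (Fin (2 * n)) × ℂ) ∞
      (fun x : Sph n => K.symm (x : Euc n)) {x | (x : Euc n) ∈ K.target} :=
    hKd'.contMDiffOn.comp hcoe.contMDiffOn fun x hx => hx
  have hΦ : ContMDiffOn (𝓡 (2 * n + 1)) ((𝓡 (2 * n)).prod (𝓡 1)) ∞ Φ₀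
      {x | (x : Euc n) ∈ K.target} := by
    refine ContMDiffOn.prodMk (contDiff_fst.contMDiff.comp_contMDiffOn h1) ?_
    refine contMDiffOn_sphere_of_coe (E := ℂ) (m := 1) ?_
    have h2 : ContDiffOn ℝ ∞ (fun q : EuclideanSpace ℝ (Fin (2 * n)) × ℂ => ‖q.2‖⁻¹ • q.2)
        {q | q.2 ≠ 0} := fun q hq =>
      (((contDiffAt_snd.norm ℝ hq).inv (norm_ne_zero_iff.2 hq)).smul
        contDiffAt_snd).contDiffWithinAt
    refine (h2.contMDiffOn.comp h1 fun x hx => (hsymm _ hx).2).congr fun x hx => ?_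
    exact coe_circle_exp_arg (hsymm _ hx).2
  have hΦ' : ContMDiffOn ((𝓡 (2 * n)).prod (𝓡 1)) (𝓡 (2 * n + 1)) ∞ (T.circles α)
      (ball 0 T.r ×ˢ univ) := by
    refine contMDiffOn_sphere_of_coe ?_
    have h2 : ContDiffOn ℝ ∞ (fun q => ‖T.planes α q‖⁻¹ • T.planes α q) (ball 0 T.r ×ˢ {0}ᶜ) := by
      rw [hKs, hK] at hKd
      have h3 : ∀ q ∈ ball (0 : EuclideanSpace ℝ (Fin (2 * n))) T.r ×ˢ ({0}ᶜ : Set ℂ),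
          T.planes α q ≠ 0 := fun q hq => T.planes_ne_zero α q.1 hq.2
      exact ((hKd.norm ℝ h3).inv fun q hq => norm_ne_zero_iff.2 (h3 q hq)).smul hKd
    have h4 : ContMDiff ((𝓡 (2 * n)).prod (𝓡 1)) 𝓘(ℝ, EuclideanSpace ℝ (Fin (2 * n)) × ℂ) ∞
        (fun q : EuclideanSpace ℝ (Fin (2 * n)) × Circle => (q.1, (q.2 : ℂ))) :=
      contMDiff_fst.prodMk_space
        ((contMDiff_coe_sphere (E := ℂ) (n := 1)).comp contMDiff_snd)
    exact h2.contMDiffOn.comp h4.contMDiffOn fun q hq => ⟨hq.1, Circle.coe_ne_zero q.2⟩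
  have hsmul : ∀ d ∈ ball 0 T.r, ∀ ζ : Circle, (T.circles α (d, ζ) : Euc n) ∈ K.target ∧
      K.symm (T.circles α (d, ζ) : Euc n) = (d, ‖T.planes α (d, ζ)‖⁻¹ • (ζ : ℂ)) := by
    intro d hd ζ
    have h0 := inv_ne_zero (norm_ne_zero_iff.2 (T.planes_ne_zero α d (Circle.coe_ne_zero ζ)))
    have h2 : (d, ‖T.planes α (d, ζ)‖⁻¹ • (ζ : ℂ)) ∈ K.source := by
      rw [hKs]
      exact ⟨hd, smul_ne_zero h0 (Circle.coe_ne_zero ζ)⟩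
    have h3 : (T.circles α (d, ζ) : Euc n) = K (d, ‖T.planes α (d, ζ)‖⁻¹ • (ζ : ℂ)) := by
      rw [hK, planes_smul]; rfl
    rw [h3]
    exact ⟨K.map_source h2, K.left_inv h2⟩
  refine ⟨
    { toFun := Φ₀
      invFun := T.circles α
      source := {x | (x : Euc n) ∈ K.target}
      target := ball 0 T.r ×ˢ univ
      map_source' := fun x hx => ⟨(hsymm _ hx).1, mem_univ _⟩
      map_target' := fun q hq => (hsmul q.1 hq.1 q.2).1
      left_inv' := fun x hx => ?_
      right_inv' := fun q hq => ?_
      open_source := K.open_target.preimage continuous_subtype_val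
      open_target := isOpen_ball.prod isOpen_univ
      continuousOn_toFun := hΦ.continuousOn
      continuousOn_invFun := hΦ'.continuousOn }, rfl, rfl, hΦ, hΦ', fun x => rfl, rfl⟩
  · obtain ⟨h2, h3⟩ := hsymm _ hx
    have h4 : T.planes α (K.symm (x : Euc n)) = x := by rw [← hK]; exact K.right_inv hx
    have h5 : T.planes α ((K.symm (x : Euc n)).1, (Circle.exp (K.symm (x : Euc n)).2.arg : ℂ)) =
        ‖(K.symm (x : Euc n)).2‖⁻¹ • (x : Euc n) := by
      rw [coe_circle_exp_arg h3, planes_smul]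
      exact congrArg _ h4
    refine Subtype.ext ?_
    change ‖T.planes α (_, _)‖⁻¹ • T.planes α (_, _) = (x : Euc n)
    rw [h5, norm_smul, norm_eq_of_mem_sphere, mul_one, norm_inv, norm_norm, inv_inv, smul_smul,
      mul_inv_cancel₀ (norm_ne_zero_iff.2 h3), one_smul]
  · obtain ⟨d, ζ⟩ := q
    have h2 := (hsmul d hq.1 ζ).2
    have h3 := inv_ne_zero (norm_ne_zero_iff.2 (T.planes_ne_zero α d (Circle.coe_ne_zero ζ)))
    refine Prod.ext (show (K.symm (T.circles α (d, ζ) : Euc n)).1 = d by rw [h2]) (Circle.ext ?_)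
    change (Circle.exp (K.symm _).2.arg : ℂ) = _
    rw [h2, coe_circle_exp_arg (smul_ne_zero h3 (Circle.coe_ne_zero ζ)), norm_smul, norm_inv,
      norm_norm, Circle.norm_coe, mul_one, smul_smul, inv_mul_cancel₀ h3, one_smul]

theorem circles_frame (hα : P.IsPositiveFrame (α 1) (α Complex.I))
    (d : EuclideanSpace ℝ (Fin (2 * n))) (θ : ℝ) :
    (P.graph (T.ψ d)).IsPositiveFrame (T.circles α (d, Circle.exp θ) : Euc n)
      (deriv (fun s : ℝ => (T.circles α (d, Circle.exp s) : Euc n)) θ) := by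
  have h : ∀ s : ℝ, T.planes α (d, Circle.exp s) =
      Real.cos s • P.graphMap (T.ψ d) (α 1) + Real.sin s • P.graphMap (T.ψ d) (α Complex.I) := by
    intro s
    have : (Circle.exp s : ℂ) = Real.cos s • (1 : ℂ) + Real.sin s • Complex.I := by
      rw [Circle.coe_exp, Complex.exp_mul_I]
      simp
    simp only [planes, this, map_add, map_smul]
  have h2 : ∀ s : ℝ, (T.circles α (d, Circle.exp s) : Euc n) = _ := fun s =>
    show ‖T.planes α (d, Circle.exp s)‖⁻¹ • T.planes α (d, Circle.exp s) = _ by rw [h]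
  simp only [h2]
  exact (hα.graph (T.ψ d)).circle θ

end TransverseChart

/-- A compact connected family of oriented planes which is transverse to the bad cones is the base
space of a smooth fibration. -/
theorem exists_fibration (hM : ∀ P ∈ M, Nonempty (TransverseChart M P)) (hcompact : IsCompact M)
    (hconn : IsConnected M) : ∃ F : SmoothGreatCircleFibration n, F.baseSpace = M := by
  have hbij := CircleBundle.bijective_proj hM hcompact hconn
  have hex : ∀ x : Sph n, ∃ P ∈ M, (x : Euc n) ∈ P.plane := fun x => by
    obtain ⟨e, rfl⟩ := hbij.2 x
    exact ⟨e.1.1, e.2.1, e.2.2.1⟩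
  have huniq : ∀ (x : Sph n) (P Q : OrientedPlane n), P ∈ M → Q ∈ M → (x : Euc n) ∈ P.plane →
      (x : Euc n) ∈ Q.plane → P = Q := fun x P Q hP hQ hxP hxQ =>
    congrArg (fun e : CircleBundle M => e.1.1)
      (hbij.1 (a₁ := CircleBundle.mk P hP x hxP) (a₂ := CircleBundle.mk Q hQ x hxQ) rfl)
  choose f hfM hf using hex
  refine ⟨⟨f, hf, fun x y hy => huniq y _ _ (hfM y) (hfM x) (hf y) hy, fun x => ?_⟩, ?_⟩
  · obtain ⟨T⟩ := hM _ (hfM x)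
    obtain ⟨α, hα⟩ := (f x).exists_isometry
    obtain ⟨K, hK, hKs, hKd, hKd'⟩ := T.exists_planes_chart α
    obtain ⟨Φ, hΦs, hΦt, hΦ, hΦ', hΦ1, hΦsymm⟩ := T.exists_circles_chart α hK hKs hKd hKd'
    refine ⟨ball 0 T.r, Φ, ?_, hΦt, hΦ, hΦ', fun d hd => ?_⟩
    · rw [hΦs]
      refine (TransverseChart.mem_target_of_mem_graph hK hKs (ne_zero_of_mem_unit_sphere x)
        (mem_ball_self T.r_pos) ?_).1
      rw [T.ψ_zero, graph_zero]
      exact hf x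
    · have hfd : ∀ y : Sph n, (y : Euc n) ∈ ((f x).graph (T.ψ d)).plane →
          f y = (f x).graph (T.ψ d) := fun y hy =>
        huniq y _ _ (hfM y) (T.graph_mem d hd) (hf y) hy
      refine ⟨T.circles α (d, 1), ?_, ?_⟩
      · rw [hΦsymm, hfd _ (T.circles_mem α d 1)]
        refine Subset.antisymm ?_ fun y hy => ?_
        · rintro _ ⟨ζ, rfl⟩
          exact T.circles_mem α d ζ
        · obtain ⟨h1, h2⟩ := TransverseChart.mem_target_of_mem_graph hK hKs
            (ne_zero_of_mem_unit_sphere y) hd hy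
          refine ⟨(Φ y).2, ?_⟩
          have h3 : Φ.symm (Φ y) = y := Φ.left_inv (by rw [hΦs]; exact h1)
          rw [hΦsymm, ← Prod.mk.eta (p := Φ y), hΦ1, h2] at h3
          exact h3
      · intro θ
        rw [hΦsymm, hfd _ (T.circles_mem α d 1)]
        exact T.circles_frame α hα d θ
  · refine Subset.antisymm ?_ fun P hP => ?_
    · rintro _ ⟨x, rfl⟩
      exact hfM x
    · obtain ⟨x, hx⟩ := P.exists_mem_norm_eq_one
      exact ⟨x, huniq x _ _ (hfM x) hP (hf x) hx⟩

end OrientedPlane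

/-! ### From a smooth fibration to transversality -/

/-- Differentiate `π' Y = γ (π Y)` at `0`: since `Y' = 0` and `γ 0 = 0`, only the term `v (π (Y 0))`
survives. -/
theorem clm_apply_eq_zero_of_hasDerivAt {A B E : Type*} [NormedAddCommGroup A] [NormedSpace ℝ A]
    [NormedAddCommGroup B] [NormedSpace ℝ B] [NormedAddCommGroup E] [NormedSpace ℝ E]
    {γ : ℝ → A →L[ℝ] B} {v : A →L[ℝ] B} (hγ : HasDerivAt γ v 0) (hγ0 : γ 0 = 0)
    {Y : ℝ → E} (hY : HasDerivAt Y 0 0) (π : E →L[ℝ] A) (π' : E →L[ℝ] B)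
    (h : ∀ᶠ t in 𝓝 0, π' (Y t) = γ t (π (Y t))) : v (π (Y 0)) = 0 := by
  have h1 : HasDerivAt (fun t => π' (Y t)) (π' 0) 0 := π'.hasFDerivAt.comp_hasDerivAt 0 hY
  have h2 : HasDerivAt (fun t => γ t (π (Y t))) (v (π (Y 0)) + γ 0 (π 0)) 0 :=
    hγ.clm_apply (π.hasFDerivAt.comp_hasDerivAt 0 hY)
  have h3 := (h2.congr_of_eventuallyEq h).unique h1
  rwa [hγ0, zero_apply, add_zero, map_zero] at h3

theorem hasDerivAt_add_clm_apply {A B E : Type*} [NormedAddCommGroup A] [NormedSpace ℝ A]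
    [NormedAddCommGroup B] [NormedSpace ℝ B] [NormedAddCommGroup E] [NormedSpace ℝ E]
    {γ : ℝ → A →L[ℝ] B} {v : A →L[ℝ] B} {t : ℝ} (hγ : HasDerivAt γ v t) (p : A) (x : E)
    (ι : B →L[ℝ] E) : HasDerivAt (fun s => x + ι (γ s p)) (ι (v p)) t :=
  (ι.hasFDerivAt.comp_hasDerivAt t
    ((ContinuousLinearMap.apply ℝ B p).hasFDerivAt.comp_hasDerivAt t hγ)).const_add x

/-- The radial projection to the unit sphere; the origin goes to `x₀`. -/
def radialProj {n : ℕ} (x₀ : Sph n) (y : Euc n) : Sph n :=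
  open Classical in if h : y ≠ 0 then ⟨‖y‖⁻¹ • y, by simp [norm_smul, h]⟩ else x₀

theorem coe_radialProj {n : ℕ} (x₀ : Sph n) {y : Euc n} (hy : y ≠ 0) :
    (radialProj x₀ y : Euc n) = ‖y‖⁻¹ • y := by
  rw [radialProj, dif_pos hy]

theorem radialProj_coe {n : ℕ} (x₀ x : Sph n) : radialProj x₀ (x : Euc n) = x := by
  refine Subtype.ext ?_
  rw [coe_radialProj _ (ne_zero_of_mem_unit_sphere x), norm_eq_of_mem_sphere, inv_one, one_smul]

theorem contMDiffOn_radialProj {n : ℕ} (x₀ : Sph n) :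
    ContMDiffOn 𝓘(ℝ, Euc n) (𝓡 (2 * n + 1)) ∞ (radialProj x₀) {y | y ≠ 0} := by
  have := Fact.mk (finrank_euclideanSpace_fin (𝕜 := ℝ) (n := 2 * n + 1 + 1))
  refine contMDiffOn_sphere_of_coe ?_
  have h : ContDiffOn ℝ ∞ (fun y : Euc n => ‖y‖⁻¹ • y) {y | y ≠ 0} := fun y hy =>
    (((contDiffAt_id.norm ℝ hy).inv (norm_ne_zero_iff.2 hy)).smul contDiffAt_id).contDiffWithinAt
  exact h.contMDiffOn.congr fun y hy => coe_radialProj x₀ hy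

namespace OrientedPlane

variable {n : ℕ}

theorem orthogonalProjection_eq_of_mem_graph {P : OrientedPlane n} {L : P.HomPerp} {x : Euc n}
    (hx : x ∈ (P.graph L).plane) :
    P.planeᗮ.orthogonalProjectionOnto x = L (P.plane.orthogonalProjectionOnto x) := by
  obtain ⟨p, rfl⟩ := hx
  rw [graphMap_apply, map_add, map_add,
    Submodule.orthogonalProjectionOnto_apply_of_mem_orthogonal
      (K := P.planeᗮ) (Submodule.le_orthogonal_orthogonal _ p.2),
    Submodule.orthogonalProjectionOnto_mem_subspace_eq_self,
    Submodule.orthogonalProjectionOnto_mem_subspace_eq_self,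
    Submodule.orthogonalProjectionOnto_apply_of_mem_orthogonal (L p).2, zero_add, add_zero]

theorem zero_mem_tangentSpaceAt {M : Set (OrientedPlane n)} {P : OrientedPlane n} (hP : P ∈ M) :
    (0 : P.HomPerp) ∈ tangentSpaceAt M P := by
  refine ⟨1, one_pos, fun _ => 0, contDiffOn_const, fun t _ => ?_, rfl,
    hasDerivAt_const (F := P.HomPerp) 0 0⟩
  rw [mem_preimage, graph_zero]
  exact hP

end OrientedPlane

namespace SmoothGreatCircleFibration

open OrientedPlane

variable {n : ℕ} (F : SmoothGreatCircleFibration n)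

theorem fibre_eq_of_mem {Q : OrientedPlane n} (hQ : Q ∈ F.baseSpace) {x : Sph n}
    (hx : (x : Euc n) ∈ Q.plane) : F.fibre x = Q := by
  obtain ⟨y, rfl⟩ := hQ
  exact F.fibre_eq y x hx

/-- The velocity of a curve of fibres vanishes if it vanishes at one point of the fibre. -/
theorem velocity_eq_zero {P : OrientedPlane n} (hP : P ∈ F.baseSpace) {γ : ℝ → P.HomPerp}
    {v : P.HomPerp} (hγ : ∀ᶠ t in 𝓝 0, P.graph (γ t) ∈ F.baseSpace) (hγ0 : γ 0 = 0)
    (hv : HasDerivAt γ v 0) {p : P.plane} (hp : ‖(p : Euc n)‖ = 1) (hvp : v p = 0) : v = 0 := by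
  let x : Sph n := ⟨p, mem_sphere_zero_iff_norm.2 hp⟩
  have hxP : F.fibre x = P := F.fibre_eq_of_mem hP p.2
  obtain ⟨D, Φ, hxs, hΦt, hΦ, hΦ', hcirc⟩ := F.locally_trivial x
  have hp0 : (p : Euc n) ≠ 0 := ne_zero_of_mem_unit_sphere x
  have hD : IsOpen D := by
    have h1 : IsOpen ((fun d => (d, (1 : Circle))) ⁻¹' Φ.target) :=
      Φ.open_target.preimage (Continuous.prodMk_left (1 : Circle))
    rw [hΦt] at h1
    convert h1 using 1
    ext d
    simp
  have hmap : ∀ y ∈ Φ.source, (Φ y).1 ∈ D := fun y hy => by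
    have := Φ.map_source hy
    rw [hΦt] at this
    exact this.1
  have hcircle : ∀ y ∈ Φ.source, ∀ z : Circle,
      (Φ.symm ((Φ y).1, z) : Euc n) ∈ (F.fibre y).plane := by
    intro y hy z
    obtain ⟨y', hy', -⟩ := hcirc _ (hmap y hy)
    have h1 : y ∈ (F.fibre y').greatCircle := by
      rw [← hy']
      exact ⟨(Φ y).2, Φ.left_inv hy⟩
    have h2 : Φ.symm ((Φ y).1, z) ∈ (F.fibre y').greatCircle := by
      rw [← hy']
      exact ⟨z, rfl⟩
    rw [F.fibre_eq y' y h1]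
    exact h2
  -- This curve follows the moving fibres from `p`, and its velocity at `0` is `v p = 0`.
  let y : ℝ → Euc n := fun t => P.graphMap (γ t) p
  have hy0 : y 0 = p := by simp only [y, hγ0, graphMap_apply]; simp
  have hy : HasDerivAt y 0 0 := by
    have h1 := hasDerivAt_add_clm_apply hv p (p : Euc n) P.planeᗮ.subtypeL
    rwa [hvp, map_zero] at h1
  let V : Set (Euc n) := {y | y ≠ 0} ∩ radialProj x ⁻¹' Φ.source
  have hV : IsOpen V := (contMDiffOn_radialProj x).continuousOn.isOpen_inter_preimage
    isOpen_ne Φ.open_source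
  have hpV : y 0 ∈ V := by
    rw [hy0]
    exact ⟨hp0, by rw [mem_preimage, radialProj_coe x x]; exact hxs⟩
  -- The label of the fibre, extended radially off the sphere so that it has an ordinary derivative.
  let d : Euc n → EuclideanSpace ℝ (Fin (2 * n)) := fun y => (Φ (radialProj x y)).1
  have hd : DifferentiableAt ℝ d (y 0) := by
    have h1 : ContMDiffOn 𝓘(ℝ, Euc n) (𝓡 (2 * n)) ∞ d V :=
      contMDiff_fst.comp_contMDiffOn (hΦ.comp ((contMDiffOn_radialProj x).mono inter_subset_left)
        inter_subset_right)
    exact ((contMDiffOn_iff_contDiffOn.1 h1).contDiffAt (hV.mem_nhds hpV)).differentiableAt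
      (by simp)
  have hyV : ∀ᶠ t in 𝓝 0, y t ∈ V := hy.continuousAt.eventually_mem (hV.mem_nhds hpV)
  -- For fixed `z`, the point with label `d (y t)` depends on `t` only through `y t`, so its
  -- velocity at `0` vanishes, while it stays in the plane of `γ t`.
  have key : ∀ z : Circle, v (P.plane.orthogonalProjectionOnto
      (Φ.symm (d (y 0), z) : Euc n)) = 0 := by
    intro z
    have hZ : DifferentiableAt ℝ (fun a => (Φ.symm (a, z) : Euc n)) (d (y 0)) := by
      have := Fact.mk (finrank_euclideanSpace_fin (𝕜 := ℝ) (n := 2 * n + 1 + 1))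
      have h1 : ContMDiff (𝓡 (2 * n)) ((𝓡 (2 * n)).prod (𝓡 1)) ∞
          (fun a : EuclideanSpace ℝ (Fin (2 * n)) => (a, z)) :=
        contMDiff_id.prodMk contMDiff_const
      have h2 : ContMDiffOn (𝓡 (2 * n)) 𝓘(ℝ, Euc n) ∞ (fun a => (Φ.symm (a, z) : Euc n)) D :=
        (contMDiff_coe_sphere (E := Euc n) (n := 2 * n + 1)).comp_contMDiffOn
          (hΦ'.comp h1.contMDiffOn fun a ha => by rw [hΦt]; exact ⟨ha, mem_univ _⟩)
      exact ((contMDiffOn_iff_contDiffOn.1 h2).contDiffAt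
        (hD.mem_nhds (hmap _ hpV.2))).differentiableAt (by simp)
    have hY : HasDerivAt (fun t => (Φ.symm (d (y t), z) : Euc n)) 0 0 := by
      have h1 := hd.hasFDerivAt.comp_hasDerivAt (0 : ℝ) hy
      have h2 := hZ.hasFDerivAt.comp_hasDerivAt (0 : ℝ) h1
      rw [map_zero, map_zero] at h2
      exact h2
    refine clm_apply_eq_zero_of_hasDerivAt hv hγ0 hY _ P.planeᗮ.orthogonalProjectionOnto ?_
    filter_upwards [hγ, hyV] with t ht htV
    refine orthogonalProjection_eq_of_mem_graph ?_
    have h1 : F.fibre (radialProj x (y t)) = P.graph (γ t) := by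
      refine F.fibre_eq_of_mem ht ?_
      rw [coe_radialProj x htV.1]
      exact Submodule.smul_mem _ _ ⟨p, rfl⟩
    rw [← h1]
    exact hcircle _ htV.2 z
  obtain ⟨y', hy', -⟩ := hcirc _ (hmap x hxs)
  have hdx : d (y 0) = (Φ x).1 := by
    simp only [d, hy0]
    rw [radialProj_coe x x]
  have hyP : F.fibre y' = P := by
    rw [← hxP]
    refine (F.fibre_eq y' x ?_).symm
    rw [← hy']
    exact ⟨(Φ x).2, Φ.left_inv hxs⟩
  -- At `t = 0` the points of `key` run through the whole great circle of `P` as `z` varies.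
  have hunit : ∀ q : P.plane, ‖q‖ = 1 → v q = 0 := by
    intro q hq
    have h1 : (⟨q, mem_sphere_zero_iff_norm.2 hq⟩ : Sph n) ∈ (F.fibre y').greatCircle := by
      rw [hyP]
      exact q.2
    rw [← hy'] at h1
    obtain ⟨z, hz⟩ := h1
    have h2 := key z
    rw [hdx] at h2
    have hz' : (Φ.symm ((Φ x).1, z) : Euc n) = q := congrArg Subtype.val hz
    rwa [hz', Submodule.orthogonalProjectionOnto_mem_subspace_eq_self] at h2
  ext q : 1
  rcases eq_or_ne q 0 with rfl | hq
  · simp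
  · have h1 := hunit (‖q‖⁻¹ • q) (by simp [norm_smul, hq])
    rw [map_smul, smul_eq_zero] at h1
    exact h1.resolve_left (inv_ne_zero (norm_ne_zero_iff.2 hq))

theorem isTransverseToBadCone {P : OrientedPlane n} (hP : P ∈ F.baseSpace) :
    IsTransverseToBadCone F.baseSpace P := by
  refine Subset.antisymm ?_ ?_
  · rintro v ⟨⟨ε, hε, γ, -, hγ, hγ0, hv⟩, hbad⟩
    obtain ⟨p, hp, hvp⟩ := mem_badCone.1 hbad
    refine F.velocity_eq_zero hP (p := ‖p‖⁻¹ • p) ?_ hγ0 hv ?_ ?_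
    · filter_upwards [Ioo_mem_nhds (neg_lt_zero.2 hε) hε] with t ht using hγ t ht
    · change ‖‖p‖⁻¹ • p‖ = 1
      simp [norm_smul, hp]
    · rw [map_smul, hvp, smul_zero]
  · rintro _ rfl
    obtain ⟨p, hp⟩ := P.exists_ne_zero
    exact ⟨zero_mem_tangentSpaceAt hP, mem_badCone.2 ⟨p, hp, rfl⟩⟩

end SmoothGreatCircleFibration

end

/-- A closed (compact, without boundary) connected smooth `2n`-dimensional submanifold `M` of the
Grassmann manifold of oriented 2-planes in `ℝ^{2n+2}` is the base space of a smooth fibration of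
`S^{2n+1}` by oriented great circles if and only if it is transverse to the bad cone at each of its
points. -/
theorem proposition1 (n : ℕ) (M : Set (OrientedPlane n))
    (hM : OrientedPlane.IsSmoothSubmanifold (2 * n) M)
    (hcompact : IsCompact M) (hconn : IsConnected M) :
    (∃ F : SmoothGreatCircleFibration n, F.baseSpace = M) ↔
      ∀ P ∈ M, OrientedPlane.IsTransverseToBadCone M P := by
  constructor
  · rintro ⟨F, rfl⟩ P hP
    exact F.isTransverseToBadCone hP
  · intro h
    exact OrientedPlane.exists_fibration (fun P hP => (h P hP).nonempty_transverseChart (hM P hP))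
      hcompact hconn
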